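/- Let $d\ge 1$, $T=[0,2\pi]$, and consider Lebesgue measurable functions $f:\mathbb R^d\to\mathbb C$ that are $2\pi$-periodic in each variable. For $i\in\{1,\dots,d\}$ and $n\ge 1$, the partial modulus of variation is $$v_i(n,f):=\sup\ \sum_{j=1}^{n}\bigl|f(x^1,\dots,x^{i-1},b_j,x^{i+1},\dots,x^d)-f(x^1,\dots,x^{i-1},a_j,x^{i+1},\dots,x^d)\bigr|\in[0,\infty],$$ where the supremum is over all values $x^k\in T$ ($k\ne i$) and over all collections of $n$ pairwise disjoint open intervals $(a_j,b_j)\subset T$, $a_j<b_j$. For such $f$, integrable over $T^d$, and $N_1,\dots,N_d\in\mathbb N$ let $$S_{N_1,\dots,N_d}(f;x)=\sum_{|n_1|\le N_1}\cdots\sum_{|n_d|\le N_d}\widehat f(n)\,e^{i(n_1x^1+\cdots+n_dx^d)},\qquad \widehat f(n)=\frac1{(2\pi)^d}\int_{T^d}f(x)e^{-i(n_1x^1+\cdots+n_dx^d)}\,dx .$$ A point $x$ is called a regular point of $f$ if for each of the $2^d$ choices of signs $\varepsilon\in\{+,-\}^d$ the limit $f(x^1\varepsilon_1 0,\dots,x^d\varepsilon_d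 0):=\lim_{t^1,\dots,t^d\downarrow 0} f(x^1\varepsilon_1t^1,\dots,x^d\varepsilon_dt^d)$ exists; in that case $f^*(x)$ denotes the arithmetic mean of these $2^d$ limits. **Theorem.** Let $V$ be the set of all such functions $f$ with $$\sum_{j=0}^{\infty}\frac{v_i(2^j,f)^{1/d}}{2^{j/d}}<\infty\qquad\text{for every } i=1,\dots,d .$$ Then $V$ is a class of convergence on $T^d$; that is, $V\subset L^1(T^d)$ and for every $f\in V$: 1. $S_{N_1,\dots,N_d}(f;x)\to f^*(x)$ as $\min(N_1,\dots,N_d)\to\infty$, at every regular point $x\in T^d$ of $f$; 2. if $K\subset T^d$ is compact and $f$ is continuous on an open set $U\subset\mathbb R^d$ containing $K$, then $S_{N_1,\dots,N_d}(f;\cdot)\to f$ uniformly on $K$ as $\min(N_1,\dots,N_d)\to\infty$. -/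

import Mathlib

open Filter Topology MeasureTheory
open scoped ENNReal Real

namespace MultipleFourier

noncomputable section

/-- The cube `T^d = [0, 2π]^d`. -/
def cube (d : ℕ) : Set (Fin d → ℝ) := Set.Icc 0 (fun _ => 2 * π)

/-- `f` is `2π`-periodic with respect to each variable. -/
def IsPeriodic {d : ℕ} (f : (Fin d → ℝ) → ℂ) : Prop :=
  ∀ i : Fin d, Function.Periodic f (Pi.single i (2 * π))

/-- The space `L¹(T^d)`, as a set of (everywhere defined) periodic functions. -/
def L1 (d : ℕ) : Set ((Fin d → ℝ) → ℂ) :=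
  {f | IsPeriodic f ∧ IntegrableOn f (cube d)}

/-- `Ω_n`: the collections of `n` nonoverlapping intervals `(a, b) ⊂ [0, 2π]`, each interval
being given by the pair `(a, b)` of its endpoints. -/
def Omega (n : ℕ) : Set (Fin n → ℝ × ℝ) :=
  {I | (∀ j, 0 ≤ (I j).1 ∧ (I j).1 < (I j).2 ∧ (I j).2 ≤ 2 * π) ∧
    ∀ j k, j ≠ k → Disjoint (Set.Ioo (I j).1 (I j).2) (Set.Ioo (I k).1 (I k).2)}

/-- The partial modulus of variation `v_i(n, f)`, with values in `[0, ∞]`. The point `x` supplies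
the fixed values of the variables other than the `i`-th one; its `i`-th coordinate is
overwritten by the endpoints of the intervals. -/
def partialModulus {d : ℕ} (i : Fin d) (n : ℕ) (f : (Fin d → ℝ) → ℂ) : ℝ≥0∞ :=
  ⨆ x ∈ cube d, ⨆ I ∈ Omega n,
    ∑ j : Fin n, ‖f (Function.update x i (I j).2) - f (Function.update x i (I j).1)‖ₑ

/-- The measurable functions, `2π`-periodic in each variable, with
`∑_{j ≥ 0} v_i(2^j, f)^{1/d} / 2^{j/d} < ∞` for every `i`. -/
def modulusClass (d : ℕ) : Set ((Fin d → ℝ) → ℂ) :=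
  {f | AEMeasurable f volume ∧ IsPeriodic f ∧
    ∀ i : Fin d,
      ∑' j : ℕ, partialModulus i (2 ^ j) f ^ (1 / (d : ℝ)) / (2 : ℝ≥0∞) ^ ((j : ℝ) / (d : ℝ)) < ∞}

/-- The Fourier coefficient `(2π)^{-d} ∫_{T^d} f(x) e^{-i(n_1 x_1 + ⋯ + n_d x_d)} dx`. -/
def fourierCoefficient {d : ℕ} (f : (Fin d → ℝ) → ℂ) (n : Fin d → ℤ) : ℂ :=
  (1 / (2 * (π : ℂ)) ^ d) *
    ∫ x in cube d, f x * Complex.exp (-(Complex.I * ∑ k, (n k : ℂ) * (x k : ℂ)))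

/-- The rectangular partial sum `S_{N_1, …, N_d}(f; x)` of the Fourier series of `f`. -/
def rectPartialSum {d : ℕ} (N : Fin d → ℕ) (f : (Fin d → ℝ) → ℂ) (x : Fin d → ℝ) : ℂ :=
  ∑ n ∈ Fintype.piFinset (fun k => Finset.Icc (-(N k : ℤ)) (N k : ℤ)),
    fourierCoefficient f n * Complex.exp (Complex.I * ∑ k, (n k : ℂ) * (x k : ℂ))

/-- The open orthant with vertex `x` and directions `s` (`true` is `+`, `false` is `-`). -/
def orthant {d : ℕ} (x : Fin d → ℝ) (s : Fin d → Bool) : Set (Fin d → ℝ) :=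
  {y | ∀ k, if s k = true then x k < y k else y k < x k}

/-- `x` is a regular point of `f`: the `2^d` limits `f(x^1 ± 0, …, x^d ± 0)` exist. -/
def IsRegularPoint {d : ℕ} (f : (Fin d → ℝ) → ℂ) (x : Fin d → ℝ) : Prop :=
  ∀ s : Fin d → Bool, ∃ l : ℂ, Tendsto f (𝓝[orthant x s] x) (𝓝 l)

/-- `f^*(x)`, the mean of the `2^d` limits `f(x^1 ± 0, …, x^d ± 0)`
(meaningful at regular points). -/
def fStar {d : ℕ} (f : (Fin d → ℝ) → ℂ) (x : Fin d → ℝ) : ℂ :=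
  (1 / (2 : ℂ) ^ d) * ∑ s : Fin d → Bool, limUnder (𝓝[orthant x s] x) f

/-- `V` is a class of convergence on `T^d`. Convergence is in the sense of Pringsheim:
`atTop` on `Fin d → ℕ` means that `min (N_1, …, N_d) → ∞`. -/
def IsClassOfConvergence (d : ℕ) (V : Set ((Fin d → ℝ) → ℂ)) : Prop :=
  V ⊆ L1 d ∧ ∀ f ∈ V,
    (∀ x ∈ cube d, IsRegularPoint f x →
      Tendsto (fun N : Fin d → ℕ => rectPartialSum N f x) atTop (𝓝 (fStar f x))) ∧
    (∀ K ⊆ cube d, IsCompact K → ∀ U : Set (Fin d → ℝ), IsOpen U → K ⊆ U → ContinuousOn f U →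
      TendstoUniformlyOn (fun (N : Fin d → ℕ) (x : Fin d → ℝ) => rectPartialSum N f x) f atTop K)

end

end MultipleFourier

/-! The partial sum at `x` is a sum over the `2^d` sign patterns of integrals of a product of
Dirichlet kernels against `f` on an orthant with vertex `x`. Each orthant kernel has integral `π ^
d`, so subtracting from `f` its limit in that orthant leaves integrals that must be shown to vanish.

Cut the orthant into boxes whose sides are dyadic multiples of the half wave lengths `mesh (N i)`.
For a fixed multi-index `κ` the box shrinks to the vertex as `N` grows, where `f` minus its limit is
small, while the kernel has `L¹` norm on the box bounded independently of `N` and `κ`. So every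
single term tends to `0` (`norm_integral_dyadicBox_le_sup`).

A summable majorant over `κ` is still needed. In one variable, the block with index `k + 1` holds `2
^ k` pairs of half waves of opposite sign. Pairing them turns the integral into differences of `f`,
bounded by the modulus of variation, divided by `2 ^ k` because of the decay of the kernel
(`norm_integral_block_le`). In a box this can be done in any one of the `d` variables, which gives
`d` competing bounds; their geometric mean is a product of `d`-th roots, and its sum over `κ`
factors into the `d` series of the hypothesis. This is where the exponent `1/d` comes from.
Dominated convergence for series concludes (`tendsto_integral_orthantKernel`).

The argument is run along an arbitrary filter with a moving point, so that pointwise and uniform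
convergence are two instances of it. -/

namespace MultipleFourier

noncomputable section

/-! ### The truncated Dirichlet kernel and its dyadic blocks -/

/-- The function `1 / sin (t / 2)`, cut off outside `(0, π]`. -/
def cscHalf (t : ℝ) : ℝ := (Set.Ioc 0 π).indicator (fun t => 1 / Real.sin (t / 2)) t

/-- The Dirichlet kernel `sin ((N + 1/2) t) / sin (t / 2)`, cut off outside `(0, π]`. -/
def halfDirichlet (N : ℕ) (t : ℝ) : ℝ := Real.sin ((N + 1 / 2) * t) * cscHalf t

/-- Half the wave length of the Dirichlet kernel. -/
def mesh (N : ℕ) : ℝ := π / (N + 1 / 2)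

/-- The dyadic blocks `(0, 2h]`, `(2h, 4h]`, `(4h, 8h]`, … -/
def dyadicBlock (h : ℝ) : ℕ → Set ℝ
  | 0 => Set.Ioc 0 (2 * h)
  | k + 1 => Set.Ioc (2 ^ (k + 1) * h) (2 ^ (k + 2) * h)

lemma mesh_pos (N : ℕ) : 0 < mesh N := by unfold mesh; positivity

lemma mul_mesh (N : ℕ) : ((N : ℝ) + 1 / 2) * mesh N = π := by unfold mesh; field_simp

lemma tendsto_mesh : Tendsto mesh atTop (𝓝 0) := by
  unfold mesh
  exact tendsto_const_nhds.div_atTop (tendsto_atTop_add_const_right _ _ tendsto_natCast_atTop_atTop)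

lemma sin_half_pos {t : ℝ} (h0 : 0 < t) (h1 : t ≤ π) : 0 < Real.sin (t / 2) :=
  Real.sin_pos_of_pos_of_lt_pi (by linarith) (by linarith)

lemma cscHalf_nonneg (t : ℝ) : 0 ≤ cscHalf t := by
  unfold cscHalf
  refine Set.indicator_nonneg (fun t ht => ?_) t
  exact (one_div_pos.2 (sin_half_pos ht.1 ht.2)).le

lemma cscHalf_le {t : ℝ} (ht : 0 < t) : cscHalf t ≤ π / t := by
  unfold cscHalf
  by_cases h : t ∈ Set.Ioc 0 π
  · rw [Set.indicator_of_mem h, div_le_div_iff₀ (sin_half_pos h.1 h.2) ht]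
    have := Real.mul_le_sin (x := t / 2) (by linarith) (by linarith [h.2])
    have h2 : 2 / π * (t / 2) * π = t := by field_simp
    nlinarith [Real.pi_pos]
  · rw [Set.indicator_of_notMem h]; positivity

/-- Cutting a nonnegative decreasing function down to `0` keeps it decreasing, so a block that
sticks out past `π` needs no separate treatment. -/
lemma cscHalf_antitoneOn : AntitoneOn cscHalf (Set.Ioi 0) := by
  intro a ha b _ hab
  rw [Set.mem_Ioi] at ha
  by_cases h : b ≤ π
  · have h1 : a ∈ Set.Ioc 0 π := ⟨ha, hab.trans h⟩
    have h2 : b ∈ Set.Ioc 0 π := ⟨ha.trans_le hab, h⟩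
    unfold cscHalf
    rw [Set.indicator_of_mem h1, Set.indicator_of_mem h2]
    refine one_div_le_one_div_of_le (sin_half_pos h1.1 h1.2) ?_
    exact Real.sin_le_sin_of_le_of_le_pi_div_two (by linarith) (by linarith) (by linarith)
  · have h2 : b ∉ Set.Ioc 0 π := fun hb => h hb.2
    have : cscHalf b = 0 := Set.indicator_of_notMem h2 _
    rw [this]; exact cscHalf_nonneg a

lemma measurable_halfDirichlet (N : ℕ) : Measurable (halfDirichlet N) := by
  unfold halfDirichlet cscHalf
  refine Measurable.mul (by fun_prop) (Measurable.indicator (by fun_prop) measurableSet_Ioc)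

lemma halfDirichlet_eq_zero {N : ℕ} {t : ℝ} (h : t ∉ Set.Ioc 0 π) : halfDirichlet N t = 0 := by
  simp [halfDirichlet, cscHalf, h]

lemma abs_halfDirichlet_le_cscHalf (N : ℕ) (t : ℝ) : |halfDirichlet N t| ≤ cscHalf t := by
  unfold halfDirichlet
  rw [abs_mul, abs_of_nonneg (cscHalf_nonneg t)]
  exact mul_le_of_le_one_left (cscHalf_nonneg t) (Real.abs_sin_le_one _)

lemma abs_halfDirichlet_le (N : ℕ) (t : ℝ) : |halfDirichlet N t| ≤ π * (N + 1 / 2) := by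
  by_cases h : t ∈ Set.Ioc 0 π
  · unfold halfDirichlet
    rw [abs_mul, abs_of_nonneg (cscHalf_nonneg t)]
    have h1 : |Real.sin ((N + 1 / 2) * t)| ≤ (N + 1 / 2) * t := by
      refine Real.abs_sin_le_abs.trans_eq (abs_of_nonneg ?_)
      have := h.1; positivity
    have h3 : 0 ≤ ((N : ℝ) + 1 / 2) * t := (abs_nonneg _).trans h1
    calc _ ≤ ((N + 1 / 2) * t) * (π / t) :=
          mul_le_mul h1 (cscHalf_le h.1) (cscHalf_nonneg t) h3
      _ = _ := by have := h.1.ne'; field_simp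
  · rw [halfDirichlet_eq_zero h, abs_zero]; positivity

lemma integrable_halfDirichlet (N : ℕ) : Integrable (halfDirichlet N) := by
  have : IntegrableOn (halfDirichlet N) (Set.Ioc 0 π) :=
    Measure.integrableOn_of_bounded (M := π * (N + 1 / 2)) (by simp)
      (measurable_halfDirichlet N).aestronglyMeasurable
      (Eventually.of_forall fun t => abs_halfDirichlet_le N t)
  exact (integrableOn_iff_integrable_of_support_subset
    (Function.support_subset_iff'.2 fun t ht => halfDirichlet_eq_zero ht)).1 this

lemma measurableSet_dyadicBlock (h : ℝ) (k : ℕ) : MeasurableSet (dyadicBlock h k) := by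
  cases k <;> exact measurableSet_Ioc

lemma dyadicBlock_subset {h : ℝ} (hh : 0 < h) (k : ℕ) :
    dyadicBlock h k ⊆ Set.Ioc 0 (2 ^ (k + 1) * h) := by
  cases k with
  | zero => simp [dyadicBlock]
  | succ k => exact Set.Ioc_subset_Ioc_left (by positivity)

lemma dyadicBlock_disjoint {h : ℝ} (hh : 0 < h) :
    Pairwise (Function.onFun Disjoint (dyadicBlock h)) := by
  refine (pairwise_disjoint_on _).2 fun m n hmn => ?_
  refine Disjoint.mono_left (dyadicBlock_subset hh m) ?_
  cases n with
  | zero => omega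
  | succ n =>
    refine Set.disjoint_left.2 fun t ht ht' => ?_
    have h1 : (2 : ℝ) ^ (m + 1) ≤ 2 ^ (n + 1) := pow_le_pow_right₀ (by norm_num) (by omega)
    have := ht.2.trans (mul_le_mul_of_nonneg_right h1 hh.le)
    exact absurd ht'.1 (not_lt.2 this)

lemma iUnion_dyadicBlock {h : ℝ} (hh : 0 < h) : ⋃ k, dyadicBlock h k = Set.Ioi 0 := by
  refine Set.Subset.antisymm (Set.iUnion_subset fun k t ht => (dyadicBlock_subset hh k ht).1) ?_
  intro t ht
  have hex : ∃ n : ℕ, t ≤ 2 ^ (n + 1) * h := by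
    obtain ⟨n, hn⟩ := pow_unbounded_of_one_lt (t / h) (one_lt_two (α := ℝ))
    refine ⟨n, ?_⟩
    rw [div_lt_iff₀ hh] at hn
    rw [pow_succ]; nlinarith [show (0 : ℝ) < 2 ^ n by positivity]
  classical
  refine Set.mem_iUnion.2 ⟨Nat.find hex, ?_⟩
  have h1 := Nat.find_spec hex
  cases hk : Nat.find hex with
  | zero => rw [hk] at h1; exact ⟨ht, by simpa using h1⟩
  | succ k =>
    rw [hk] at h1
    exact ⟨not_le.1 (Nat.find_min hex (by omega : k < Nat.find hex)), h1⟩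

lemma abs_halfDirichlet_le_of_mem_block {N k : ℕ} {t : ℝ}
    (ht : t ∈ dyadicBlock (mesh N) (k + 1)) :
    |halfDirichlet N t| ≤ π / (2 ^ (k + 1) * mesh N) := by
  have h0 : 0 < 2 ^ (k + 1) * mesh N := mul_pos (by positivity) (mesh_pos N)
  refine (abs_halfDirichlet_le_cscHalf N t).trans ((cscHalf_le (h0.trans ht.1)).trans ?_)
  exact div_le_div_of_nonneg_left Real.pi_pos.le h0 ht.1.le

/-- On the first block the kernel is at most `π * (N + 1/2)` and the length is `2 * mesh N`. On a
later block the kernel is at most `π` over the left endpoint, and the length equals that endpoint.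
-/
lemma integral_abs_block_le (N k : ℕ) :
    ∫ t in dyadicBlock (mesh N) k, |halfDirichlet N t| ≤ 2 * π ^ 2 := by
  have key : ∀ C a b : ℝ, a ≤ b → (∀ t ∈ Set.Ioc a b, |halfDirichlet N t| ≤ C) →
      ∫ t in Set.Ioc a b, |halfDirichlet N t| ≤ C * (b - a) := by
    intro C a b hab hC
    have := norm_setIntegral_le_of_norm_le_const (μ := volume) (s := Set.Ioc a b)
      (f := fun t => |halfDirichlet N t|) (C := C) (by simp)
      (fun t ht => by simpa using hC t ht)
    refine (le_abs_self _).trans (this.trans_eq ?_)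
    simp [Measure.real, ENNReal.toReal_ofReal (sub_nonneg.2 hab)]
  have hm := mesh_pos N
  have hpi := Real.pi_gt_three
  cases k with
  | zero =>
    refine (key _ _ _ (by positivity) fun t _ => abs_halfDirichlet_le N t).trans_eq ?_
    have := mul_mesh N
    linear_combination (2 * π) * this
  | succ k =>
    have h2 : (2 : ℝ) ^ (k + 1) * mesh N ≤ 2 ^ (k + 2) * mesh N :=
      mul_le_mul_of_nonneg_right (pow_le_pow_right₀ (by norm_num) (by omega)) hm.le
    refine (key _ _ _ h2 fun t ht => abs_halfDirichlet_le_of_mem_block ht).trans ?_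
    have : π / (2 ^ (k + 1) * mesh N) * (2 ^ (k + 2) * mesh N - 2 ^ (k + 1) * mesh N) = π := by
      field_simp; ring
    rw [this]; nlinarith

/-! ### Cancellation between half waves in one variable -/

lemma sum_range_two_mul {M : Type*} [AddCommMonoid M] (a : ℕ → M) (n : ℕ) :
    ∑ j ∈ Finset.range (2 * n), a j = ∑ j ∈ Finset.range n, (a (2 * j) + a (2 * j + 1)) := by
  induction n with
  | zero => simp
  | succ n ih =>
    rw [Finset.sum_range_succ _ n, ← ih, show 2 * (n + 1) = 2 * n + 1 + 1 by ring,
      Finset.sum_range_succ, Finset.sum_range_succ, add_assoc]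

lemma integral_eq_integral_sum_pairs {F : ℝ → ℂ} {A h : ℝ} (hh : 0 < h) (n : ℕ)
    (hF : IntegrableOn F (Set.Ioc A (A + 2 * n * h))) :
    ∫ t in Set.Ioc A (A + 2 * n * h), F t =
      ∫ u in (0 : ℝ)..h, ∑ j ∈ Finset.range n,
        (F (A + 2 * j * h + u) + F (A + 2 * j * h + u + h)) := by
  have hle : A ≤ A + 2 * n * h := by have : 0 ≤ 2 * (n : ℝ) * h := by positivity
                                     linarith
  have hint : ∀ j < 2 * n, IntervalIntegrable F volume (A + j * h) (A + (j + 1 : ℕ) * h) := by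
    intro j hj
    have h1 : (j : ℝ) + 1 ≤ 2 * n := by exact_mod_cast hj
    rw [intervalIntegrable_iff_integrableOn_Ioc_of_le (by push_cast; nlinarith)]
    refine hF.mono_set (Set.Ioc_subset_Ioc ?_ ?_)
    · have : 0 ≤ (j : ℝ) * h := by positivity
      linarith
    · push_cast; nlinarith
  have hint' : ∀ j < 2 * n, IntervalIntegrable (fun u => F (A + j * h + u)) volume 0 h := by
    intro j hj
    have := (hint j hj).comp_add_left (A + j * h)
    convert this using 1
    · ring
    · push_cast; ring
  have hadj := intervalIntegral.sum_integral_adjacent_intervals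
    (f := F) (μ := volume) (a := fun j : ℕ => A + j * h) (n := 2 * n) hint
  rw [← intervalIntegral.integral_of_le hle]
  have e1 : A + ((0 : ℕ) : ℝ) * h = A := by simp
  have e2 : A + ((2 * n : ℕ) : ℝ) * h = A + 2 * n * h := by push_cast; ring
  simp only [e1, e2] at hadj
  rw [← hadj]
  have e3 : ∀ j : ℕ, ∫ t in (A + j * h)..(A + (j + 1 : ℕ) * h), F t =
      ∫ u in (0 : ℝ)..h, F (A + j * h + u) := by
    intro j
    rw [intervalIntegral.integral_comp_add_left (fun t => F t)]
    congr 1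
    · ring
    · push_cast; ring
  simp only [e3]
  rw [sum_range_two_mul, intervalIntegral.integral_finsetSum]
  · refine Finset.sum_congr rfl fun j hj => ?_
    have hj' := Finset.mem_range.1 hj
    have h1 := hint' (2 * j) (by omega)
    have h2 := hint' (2 * j + 1) (by omega)
    rw [← intervalIntegral.integral_add h1 h2]
    refine intervalIntegral.integral_congr fun u _ => ?_
    congr 2
    · push_cast; ring
    · push_cast; ring
  · intro j hj
    have hj' := Finset.mem_range.1 hj
    have h1 := hint' (2 * j) (by omega)
    have h2 := hint' (2 * j + 1) (by omega)
    convert h1.add h2 using 1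
    funext u
    simp only [Nat.cast_mul, Nat.cast_add, Nat.cast_ofNat, Nat.cast_one]
    congr 2
    · ring

/-- A shift by one half wave flips the sign of the sine. Each pair therefore gives a difference of
`g`, weighted by at most `π / A`, plus a difference of `cscHalf` times `g`; the latter differences
telescope because `cscHalf` decreases. -/
lemma norm_integral_block_le {g : ℝ → ℂ} {S V : ℝ} {N k : ℕ} (hS : ∀ t, ‖g t‖ ≤ S)
    (hV : ∀ t h : ℝ, 0 < h → t + 2 ^ (k + 1) * h ≤ 2 * π + h → 0 ≤ t →
      ∑ j ∈ Finset.range (2 ^ k), ‖g (t + 2 * j * h) - g (t + 2 * j * h + h)‖ ≤ V) :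
    ‖∫ t in dyadicBlock (mesh N) (k + 1), (halfDirichlet N t : ℂ) * g t‖ ≤
      2 * π ^ 2 * ((V + S) / 2 ^ k) := by
  have hm := mesh_pos N
  set h := mesh N with hh
  have hS0 : 0 ≤ S := (norm_nonneg _).trans (hS 0)
  have hV0 : 0 ≤ V := by
    -- Any admissible choice shows `0 ≤ V`; here the `2 ^ (k + 1)` steps fill `[0, 2π]`.
    refine (Finset.sum_nonneg fun j _ => norm_nonneg _).trans (hV 0 (2 * π / 2 ^ (k + 1)) (by positivity) ?_ le_rfl)
    have : (2 : ℝ) ^ (k + 1) * (2 * π / 2 ^ (k + 1)) = 2 * π := by field_simp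
    rw [this]; have : 0 < 2 * π / 2 ^ (k + 1) := by positivity
    linarith
  have hRHS : 0 ≤ 2 * π ^ 2 * ((V + S) / 2 ^ k) := by positivity
  -- `g` is not assumed measurable, so that the bound applies to every slice of a function of `d`
  -- variables; a non-integrable integrand has integral `0` by convention.
  by_cases hint : IntegrableOn (fun t => (halfDirichlet N t : ℂ) * g t) (dyadicBlock h (k + 1))
  swap
  · rw [integral_undef hint]; simpa using hRHS
  set A := 2 ^ (k + 1) * h with hA
  have hA0 : 0 < A := by positivity
  have hblock : dyadicBlock h (k + 1) = Set.Ioc A (A + 2 * (2 ^ k : ℕ) * h) := by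
    simp only [dyadicBlock]; congr 1; rw [hA]; push_cast; ring
  by_cases hAp : π ≤ A
  · rw [setIntegral_eq_zero_of_forall_eq_zero]
    · simpa using hRHS
    · intro t ht
      rw [hblock] at ht
      rw [halfDirichlet_eq_zero fun h' => absurd ht.1 (not_lt.2 (h'.2.trans hAp))]
      simp
  rw [not_le] at hAp
  rw [hblock] at hint ⊢
  rw [integral_eq_integral_sum_pairs hm _ hint]
  have hcscA : cscHalf A ≤ π / A := cscHalf_le hA0
  have bound : ∀ u ∈ Set.uIoc 0 h, ‖∑ j ∈ Finset.range (2 ^ k),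
      ((halfDirichlet N (A + 2 * j * h + u) : ℂ) * g (A + 2 * j * h + u) +
      (halfDirichlet N (A + 2 * j * h + u + h) : ℂ) * g (A + 2 * j * h + u + h))‖ ≤
      π / A * (V + S) := by
    intro u hu
    rw [Set.uIoc_of_le hm.le] at hu
    have hu0 := hu.1
    have hu1 := hu.2
    have pos : ∀ j : ℕ, 0 < A + 2 * j * h + u := fun j => by positivity
    have geA : ∀ j : ℕ, A ≤ A + 2 * j * h + u := fun j => by
      have : 0 ≤ 2 * (j : ℝ) * h := by positivity
      linarith
    -- `A` is an even multiple of the half wave length, so the phase depends on `u` only.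
    have s1 : ∀ j : ℕ, halfDirichlet N (A + 2 * j * h + u) =
        Real.sin ((N + 1 / 2) * u) * cscHalf (A + 2 * j * h + u) := by
      intro j
      unfold halfDirichlet
      congr 1
      rw [← Real.sin_add_nat_mul_two_pi ((N + 1 / 2) * u) (2 ^ k + j)]
      congr 1
      push_cast
      have := mul_mesh N
      rw [← hh] at this
      rw [← this, hA]; ring
    have s2 : ∀ j : ℕ, halfDirichlet N (A + 2 * j * h + u + h) =
        -(Real.sin ((N + 1 / 2) * u) * cscHalf (A + 2 * j * h + u + h)) := by
      intro j
      unfold halfDirichlet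
      rw [← neg_mul]
      congr 1
      rw [← Real.sin_add_pi, ← Real.sin_add_nat_mul_two_pi ((N + 1 / 2) * u + π) (2 ^ k + j)]
      congr 1
      push_cast
      have := mul_mesh N
      rw [← hh] at this
      rw [← this, hA]; ring
    have term : ∀ j : ℕ, ‖(halfDirichlet N (A + 2 * j * h + u) : ℂ) * g (A + 2 * j * h + u) +
        (halfDirichlet N (A + 2 * j * h + u + h) : ℂ) * g (A + 2 * j * h + u + h)‖ ≤
        π / A * ‖g (A + u + 2 * j * h) - g (A + u + 2 * j * h + h)‖ +
        S * (cscHalf (A + 2 * j * h + u) - cscHalf (A + 2 * (j + 1 : ℕ) * h + u)) := by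
      intro j
      rw [s1, s2, show A + u + 2 * j * h = A + 2 * j * h + u by ring]
      set p := A + 2 * j * h + u with hp
      have hp0 : 0 < p := pos j
      have e : ((Real.sin ((N + 1 / 2) * u) * cscHalf p : ℝ) : ℂ) * g p +
          ((-(Real.sin ((N + 1 / 2) * u) * cscHalf (p + h)) : ℝ) : ℂ) * g (p + h) =
          (Real.sin ((N + 1 / 2) * u) : ℂ) * ((cscHalf (p + h) : ℂ) * (g p - g (p + h)) +
            ((cscHalf p - cscHalf (p + h) : ℝ) : ℂ) * g p) := by
        push_cast; ring
      rw [e, norm_mul]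
      have hsin : ‖(Real.sin ((N + 1 / 2) * u) : ℂ)‖ ≤ 1 := by
        rw [Complex.norm_real]; exact Real.abs_sin_le_one _
      refine (mul_le_of_le_one_left (norm_nonneg _) hsin).trans ((norm_add_le _ _).trans ?_)
      have hanti : cscHalf (p + h) ≤ cscHalf p :=
        cscHalf_antitoneOn (Set.mem_Ioi.2 hp0) (Set.mem_Ioi.2 (by linarith)) (by linarith)
      -- Lowering the subtracted value to the one at the start of the next pair makes the sum
      -- telescope.
      have hanti2 : cscHalf (A + 2 * (j + 1 : ℕ) * h + u) ≤ cscHalf (p + h) :=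
        cscHalf_antitoneOn (Set.mem_Ioi.2 (by linarith)) (Set.mem_Ioi.2 (pos (j + 1)))
          (by push_cast; rw [hp]; linarith)
      have hanti3 : cscHalf (p + h) ≤ cscHalf A :=
        cscHalf_antitoneOn (Set.mem_Ioi.2 hA0) (Set.mem_Ioi.2 (by linarith))
          (by linarith [geA j])
      rw [norm_mul, norm_mul, Complex.norm_real, Complex.norm_real, Real.norm_eq_abs,
        Real.norm_eq_abs, abs_of_nonneg (cscHalf_nonneg _), abs_of_nonneg (sub_nonneg.2 hanti)]
      refine add_le_add (mul_le_mul_of_nonneg_right (hanti3.trans hcscA) (norm_nonneg _)) ?_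
      rw [mul_comm S]
      exact mul_le_mul (by linarith) (hS p) (norm_nonneg _) (by linarith)
    refine (norm_sum_le _ _).trans ((Finset.sum_le_sum fun j _ => term j).trans ?_)
    rw [Finset.sum_add_distrib, ← Finset.mul_sum, ← Finset.mul_sum,
      Finset.sum_range_sub' (fun j : ℕ => cscHalf (A + 2 * j * h + u))]
    -- Since `A < π` and `u ≤ h`, the last sample point `2 * A + u - h` is at most `2π`.
    have hV' := hV (A + u) h hm (by linarith) (by positivity)
    have h0 : cscHalf (A + 2 * (0 : ℕ) * h + u) ≤ cscHalf A :=
      cscHalf_antitoneOn (Set.mem_Ioi.2 hA0) (Set.mem_Ioi.2 (pos 0)) (geA 0)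
    have hn := cscHalf_nonneg (A + 2 * (2 ^ k : ℕ) * h + u)
    rw [mul_add]
    refine add_le_add (mul_le_mul_of_nonneg_left hV' (by positivity)) ?_
    rw [mul_comm]
    exact mul_le_mul_of_nonneg_right ((sub_le_self _ hn).trans (h0.trans hcscA)) hS0
  refine (intervalIntegral.norm_integral_le_of_norm_le_const bound).trans ?_
  rw [sub_zero, abs_of_pos hm, hA]
  have : π / (2 ^ (k + 1) * h) * (V + S) * h = π / 2 * ((V + S) / 2 ^ k) := by
    field_simp; ring
  rw [this]
  refine mul_le_mul_of_nonneg_right ?_ (by positivity)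
  nlinarith [Real.pi_gt_three]

/-! ### Estimates on dyadic boxes -/

/-- The product kernel `∏ halfDirichlet (N k) (t k)`. -/
def orthantKernel {d : ℕ} (N : Fin d → ℕ) (t : Fin d → ℝ) : ℂ :=
  ∏ i, (halfDirichlet (N i) (t i) : ℂ)

/-- Boxes whose sides are dyadic blocks. -/
def dyadicBox {d : ℕ} (N : Fin d → ℕ) (κ : Fin d → ℕ) : Set (Fin d → ℝ) :=
  Set.univ.pi fun i => dyadicBlock (mesh (N i)) (κ i)

/-- The Dirichlet kernel restricted to a dyadic block. -/
def blockKernel (N k : ℕ) (t : ℝ) : ℂ :=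
  (dyadicBlock (mesh N) k).indicator (fun t => (halfDirichlet N t : ℂ)) t

/-- The weights `S`, `V 0 + S`, `(V 1 + S) / 2`, `(V 2 + S) / 4`, … -/
def blockWeight (S : ℝ) (V : ℕ → ℝ) : ℕ → ℝ
  | 0 => S
  | k + 1 => (V k + S) / 2 ^ k

lemma integrable_blockKernel (N k : ℕ) : Integrable (blockKernel N k) :=
  (integrable_halfDirichlet N).ofReal.indicator (measurableSet_dyadicBlock _ _)

lemma norm_blockKernel (N k : ℕ) (t : ℝ) :
    ‖blockKernel N k t‖ =
      (dyadicBlock (mesh N) k).indicator (fun t => |halfDirichlet N t|) t := by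
  unfold blockKernel
  by_cases h : t ∈ dyadicBlock (mesh N) k <;> simp [h]

lemma integral_norm_blockKernel_le (N k : ℕ) : ∫ t, ‖blockKernel N k t‖ ≤ 2 * π ^ 2 := by
  simp only [norm_blockKernel]
  rw [integral_indicator (measurableSet_dyadicBlock _ _)]
  exact integral_abs_block_le N k

lemma measurableSet_dyadicBox {d : ℕ} (N κ : Fin d → ℕ) : MeasurableSet (dyadicBox N κ) :=
  MeasurableSet.univ_pi fun _ => measurableSet_dyadicBlock _ _

lemma indicator_dyadicBox {d : ℕ} (N κ : Fin d → ℕ) (φ : (Fin d → ℝ) → ℂ) :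
    (dyadicBox N κ).indicator (fun t => orthantKernel N t * φ t) =
      fun t => (∏ i, blockKernel (N i) (κ i) (t i)) * φ t := by
  funext t
  by_cases h : t ∈ dyadicBox N κ
  · rw [Set.indicator_of_mem h]
    unfold orthantKernel
    congr 1
    refine Finset.prod_congr rfl fun i _ => ?_
    unfold blockKernel
    rw [Set.indicator_of_mem (h i (Set.mem_univ i))]
  · rw [Set.indicator_of_notMem h]
    have : ∃ i, t i ∉ dyadicBlock (mesh (N i)) (κ i) := by
      by_contra hcon
      push Not at hcon
      exact h fun i _ => hcon i
    obtain ⟨i, hi⟩ := this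
    rw [Finset.prod_eq_zero (Finset.mem_univ i), zero_mul]
    unfold blockKernel
    rw [Set.indicator_of_notMem hi]

lemma setIntegral_dyadicBox {d : ℕ} (N κ : Fin d → ℕ) (φ : (Fin d → ℝ) → ℂ) :
    ∫ t in dyadicBox N κ, orthantKernel N t * φ t =
      ∫ t, (∏ i, blockKernel (N i) (κ i) (t i)) * φ t := by
  rw [← integral_indicator (measurableSet_dyadicBox N κ), indicator_dyadicBox]

lemma integrable_orthantKernel {d : ℕ} (N : Fin d → ℕ) : Integrable (orthantKernel N) := by
  unfold orthantKernel
  exact Integrable.fintype_prod fun i => (integrable_halfDirichlet (N i)).ofReal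

lemma integrable_prod_blockKernel {d : ℕ} (N κ : Fin d → ℕ) :
    Integrable (fun t : Fin d → ℝ => ∏ i, blockKernel (N i) (κ i) (t i)) :=
  Integrable.fintype_prod fun i => integrable_blockKernel (N i) (κ i)

lemma integral_norm_prod_blockKernel_le {d : ℕ} (N κ : Fin d → ℕ) :
    ∫ t : Fin d → ℝ, ‖∏ i, blockKernel (N i) (κ i) (t i)‖ ≤ (2 * π ^ 2) ^ d := by
  simp only [norm_prod]
  rw [integral_fintype_prod_volume_eq_prod fun i t => ‖blockKernel (N i) (κ i) t‖]
  refine (Finset.prod_le_prod (fun i _ => integral_nonneg fun _ => norm_nonneg _)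
    fun i _ => integral_norm_blockKernel_le (N i) (κ i)).trans_eq ?_
  simp

lemma norm_integral_dyadicBox_le_sup {d : ℕ} {N κ : Fin d → ℕ} {φ : (Fin d → ℝ) → ℂ} {ε : ℝ}
    (hε : 0 ≤ ε) (hφ : ∀ t ∈ dyadicBox N κ, ‖φ t‖ ≤ ε) :
    ‖∫ t in dyadicBox N κ, orthantKernel N t * φ t‖ ≤ (2 * π ^ 2) ^ d * ε := by
  rw [setIntegral_dyadicBox]
  refine (norm_integral_le_of_norm_le ((integrable_prod_blockKernel N κ).norm.mul_const ε)
    (Eventually.of_forall fun t => ?_)).trans ?_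
  · rw [norm_mul]
    by_cases h : t ∈ dyadicBox N κ
    · exact mul_le_mul_of_nonneg_left (hφ t h) (norm_nonneg _)
    · have := congrFun (indicator_dyadicBox N κ fun _ => 1) t
      rw [Set.indicator_of_notMem h, mul_one] at this
      rw [← this]; simp
  · rw [integral_mul_const]
    exact mul_le_mul_of_nonneg_right (integral_norm_prod_blockKernel_le N κ) hε

lemma norm_integral_blockKernel_mul_le {g : ℝ → ℂ} {S : ℝ} {V : ℕ → ℝ} (N k : ℕ)
    (hS : ∀ t, ‖g t‖ ≤ S)
    (hV : ∀ (k : ℕ) (t h : ℝ), 0 < h → t + 2 ^ (k + 1) * h ≤ 2 * π + h → 0 ≤ t →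
      ∑ j ∈ Finset.range (2 ^ k), ‖g (t + 2 * j * h) - g (t + 2 * j * h + h)‖ ≤ V k) :
    ‖∫ t, blockKernel N k t * g t‖ ≤ 2 * π ^ 2 * blockWeight S V k := by
  have hS0 : 0 ≤ S := (norm_nonneg _).trans (hS 0)
  cases k with
  | zero =>
    refine (norm_integral_le_of_norm_le ((integrable_blockKernel N 0).norm.mul_const S)
      (Eventually.of_forall fun t => ?_)).trans ?_
    · rw [norm_mul]; exact mul_le_mul_of_nonneg_left (hS t) (norm_nonneg _)
    · rw [integral_mul_const]
      exact mul_le_mul_of_nonneg_right (integral_norm_blockKernel_le N 0) hS0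
  | succ k =>
    have e : (fun t => blockKernel N (k + 1) t * g t) =
        (dyadicBlock (mesh N) (k + 1)).indicator fun t => (halfDirichlet N t : ℂ) * g t := by
      funext t
      unfold blockKernel
      by_cases h : t ∈ dyadicBlock (mesh N) (k + 1) <;> simp [h]
    rw [e, integral_indicator (measurableSet_dyadicBlock _ _)]
    exact norm_integral_block_le hS (hV k)

/-- By Fubini, the cancellation is used in the `i`-th variable alone; each remaining variable costs
the `L¹` bound `2 * π ^ 2`. -/
lemma norm_integral_dyadicBox_le {d : ℕ} (N κ : Fin d → ℕ) {φ : (Fin d → ℝ) → ℂ}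
    (hφ : AEStronglyMeasurable φ) {S : ℝ} (hS : ∀ t, ‖φ t‖ ≤ S) (i : Fin d) {V : ℕ → ℝ}
    (hV : ∀ (x : Fin d → ℝ) (k : ℕ) (t h : ℝ), 0 < h → t + 2 ^ (k + 1) * h ≤ 2 * π + h → 0 ≤ t →
      ∑ j ∈ Finset.range (2 ^ k), ‖φ (Function.update x i (t + 2 * j * h)) -
        φ (Function.update x i (t + 2 * j * h + h))‖ ≤ V k) :
    ‖∫ t in dyadicBox N κ, orthantKernel N t * φ t‖ ≤
      (2 * π ^ 2) ^ d * blockWeight S V (κ i) := by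
  obtain ⟨n, rfl⟩ : ∃ n, d = n + 1 := ⟨d - 1, by have := i.2; omega⟩
  have hint : Integrable (fun t => (∏ i, blockKernel (N i) (κ i) (t i)) * φ t) :=
    (integrable_prod_blockKernel N κ).mul_bdd hφ (Eventually.of_forall hS)
  rw [setIntegral_dyadicBox]
  have hmp := (volume_preserving_piFinSuccAbove (fun _ : Fin (n + 1) => ℝ) i).symm
  rw [← hmp.integral_comp']
  have hint' := (hmp.integrable_comp_emb (MeasurableEquiv.measurableEmbedding _)).2 hint
  rw [Measure.volume_eq_prod] at hint' ⊢
  simp only [Function.comp_def] at hint'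
  rw [integral_prod_symm _ hint']
  have hB := integrable_prod_blockKernel (fun j => N (i.succAbove j)) (fun j => κ (i.succAbove j))
  have hρ : ∀ b : Fin n → ℝ,
      ‖∫ a, blockKernel (N i) (κ i) a * φ (i.insertNth (α := fun _ => ℝ) a b)‖ ≤
        2 * π ^ 2 * blockWeight S V (κ i) := by
    intro b
    refine norm_integral_blockKernel_mul_le (N i) (κ i) (fun t => hS _) fun k t h hh h1 h2 => ?_
    have := hV (i.insertNth (α := fun _ => ℝ) 0 b) k t h hh h1 h2
    simpa only [Fin.update_insertNth] using this
  refine (norm_integral_le_of_norm_le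
    (hB.norm.mul_const (2 * π ^ 2 * blockWeight S V (κ i)))
    (Eventually.of_forall fun b => ?_)).trans ?_
  · have e : ∀ a : ℝ,
        (∏ j, blockKernel (N j) (κ j)
          ((MeasurableEquiv.piFinSuccAbove (fun _ : Fin (n + 1) => ℝ) i).symm (a, b) j)) *
          φ ((MeasurableEquiv.piFinSuccAbove (fun _ : Fin (n + 1) => ℝ) i).symm (a, b)) =
        (∏ j, blockKernel (N (i.succAbove j)) (κ (i.succAbove j)) (b j)) *
          (blockKernel (N i) (κ i) a * φ (i.insertNth (α := fun _ => ℝ) a b)) := by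
      intro a
      have : (MeasurableEquiv.piFinSuccAbove (fun _ : Fin (n + 1) => ℝ) i).symm (a, b) =
        i.insertNth (α := fun _ => ℝ) a b := rfl
      rw [this, Fin.prod_univ_succAbove _ i]
      simp only [Fin.insertNth_apply_same, Fin.insertNth_apply_succAbove]
      ring
    simp only [e]
    rw [integral_const_mul, norm_mul]
    exact mul_le_mul_of_nonneg_left (hρ b) (norm_nonneg _)
  · rw [integral_mul_const, pow_succ (2 * π ^ 2) n, mul_assoc ((2 * π ^ 2) ^ n)]
    refine mul_le_mul_of_nonneg_right (integral_norm_prod_blockKernel_le _ _) ?_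
    exact (norm_nonneg _).trans (hρ 0)

/-! ### Geometric mean and summation over the boxes -/

lemma summable_prod_pi {d : ℕ} {f : Fin d → ℕ → ℝ} (hf0 : ∀ i k, 0 ≤ f i k)
    (hf : ∀ i, Summable (f i)) : Summable fun κ : Fin d → ℕ => ∏ i, f i (κ i) := by
  classical
  refine summable_of_sum_le (c := ∏ i, ∑' k, f i k)
    (fun κ => Finset.prod_nonneg fun i _ => hf0 i _) fun u => ?_
  -- A finite set of multi-indices lies in the product of its projections, over which the sum of
  -- products factors.
  have hsub : u ⊆ Fintype.piFinset fun i => u.image fun κ => κ i := fun κ hκ =>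
    Fintype.mem_piFinset.2 fun i => Finset.mem_image_of_mem _ hκ
  refine (Finset.sum_le_sum_of_subset_of_nonneg hsub
    fun κ _ _ => Finset.prod_nonneg fun i _ => hf0 i _).trans ?_
  rw [← Finset.prod_univ_sum]
  exact Finset.prod_le_prod (fun i _ => Finset.sum_nonneg fun k _ => hf0 i k)
    fun i _ => (hf i).sum_le_tsum _ fun k _ => hf0 i k

/-- The geometric mean of the `d` bounds, one per variable, is the source of the exponent `1/d`. -/
lemma le_prod_rpow {d : ℕ} (hd : 0 < d) {x C : ℝ} {ρ : Fin d → ℝ} (hx : 0 ≤ x) (hC : 0 ≤ C)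
    (hρ : ∀ i, 0 ≤ ρ i) (h : ∀ i, x ≤ C * ρ i) : x ≤ C * ∏ i, ρ i ^ (1 / (d : ℝ)) := by
  have hd' : (d : ℝ) ≠ 0 := by positivity
  have e : ∀ y : ℝ, 0 ≤ y → ∏ _i : Fin d, y ^ (1 / (d : ℝ)) = y := by
    intro y hy
    rw [Finset.prod_const, Finset.card_univ, Fintype.card_fin, one_div,
      Real.rpow_inv_natCast_pow hy hd.ne']
  calc x = ∏ _i : Fin d, x ^ (1 / (d : ℝ)) := (e x hx).symm
    _ ≤ ∏ i : Fin d, (C * ρ i) ^ (1 / (d : ℝ)) :=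
        Finset.prod_le_prod (fun _ _ => by positivity)
          fun i _ => Real.rpow_le_rpow hx (h i) (by positivity)
    _ = C * ∏ i, ρ i ^ (1 / (d : ℝ)) := by
        simp only [fun i => Real.mul_rpow hC (hρ i) (z := 1 / (d : ℝ))]
        rw [Finset.prod_mul_distrib, e C hC]

lemma iUnion_dyadicBox {d : ℕ} (N : Fin d → ℕ) :
    ⋃ κ, dyadicBox N κ = Set.univ.pi fun _ => Set.Ioi 0 := by
  unfold dyadicBox
  rw [Set.iUnion_univ_pi fun i k => dyadicBlock (mesh (N i)) k]
  simp only [iUnion_dyadicBlock (mesh_pos _)]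

lemma dyadicBox_disjoint {d : ℕ} (N : Fin d → ℕ) :
    Pairwise (Function.onFun Disjoint (dyadicBox N)) := by
  intro κ κ' hne
  obtain ⟨i, hi⟩ := Function.ne_iff.1 hne
  refine Set.disjoint_left.2 fun t ht ht' => ?_
  exact Set.disjoint_left.1 (dyadicBlock_disjoint (mesh_pos (N i)) hi)
    (ht i (Set.mem_univ i)) (ht' i (Set.mem_univ i))

/-- Dominated convergence for the series over boxes: smallness near the vertex kills each term, and
the geometric mean of the variation bounds is a majorant independent of `a`. -/
theorem tendsto_integral_orthantKernel {ι : Type*} {l : Filter ι} {d : ℕ} (hd : 0 < d)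
    {N : ι → Fin d → ℕ} (hN : Tendsto N l atTop) {φ : ι → (Fin d → ℝ) → ℂ}
    (hφ : ∀ a, AEStronglyMeasurable (φ a)) {S : ℝ} (hS0 : 0 ≤ S) (hS : ∀ a t, ‖φ a t‖ ≤ S)
    {V : Fin d → ℕ → ℝ} (hV0 : ∀ i k, 0 ≤ V i k)
    (hsum : ∀ i, Summable fun k => ((V i k + S) / 2 ^ k) ^ (1 / (d : ℝ)))
    (hV : ∀ a i (x : Fin d → ℝ) (k : ℕ) (t h : ℝ), 0 < h →
      t + 2 ^ (k + 1) * h ≤ 2 * π + h → 0 ≤ t →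
      ∑ j ∈ Finset.range (2 ^ k), ‖φ a (Function.update x i (t + 2 * j * h)) -
        φ a (Function.update x i (t + 2 * j * h + h))‖ ≤ V i k)
    (hsmall : ∀ ε > 0, ∃ δ > 0, ∀ᶠ a in l, ∀ t : Fin d → ℝ, (∀ i, 0 < t i ∧ t i < δ) →
      ‖φ a t‖ ≤ ε) :
    Tendsto (fun a => ∫ t in Set.univ.pi fun _ => Set.Ioi 0, orthantKernel (N a) t * φ a t) l
      (𝓝 0) := by
  have hC : (0 : ℝ) < (2 * π ^ 2) ^ d := by positivity
  have hw0 : ∀ i k, 0 ≤ blockWeight S (V i) k := by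
    intro i k
    cases k with
    | zero => exact hS0
    | succ k => exact div_nonneg (add_nonneg (hV0 i k) hS0) (by positivity)
  have hint : ∀ a, Integrable fun t => orthantKernel (N a) t * φ a t := fun a =>
    (integrable_orthantKernel (N a)).mul_bdd (hφ a) (Eventually.of_forall (hS a))
  have hsplit : ∀ a, ∫ t in Set.univ.pi fun _ => Set.Ioi 0, orthantKernel (N a) t * φ a t =
      ∑' κ, ∫ t in dyadicBox (N a) κ, orthantKernel (N a) t * φ a t := by
    intro a
    rw [← iUnion_dyadicBox (N a)]
    exact integral_iUnion (measurableSet_dyadicBox _) (dyadicBox_disjoint _) (hint a).integrableOn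
  simp only [hsplit]
  have key := tendsto_tsum_of_dominated_convergence (𝓕 := l)
    (f := fun a κ => ∫ t in dyadicBox (N a) κ, orthantKernel (N a) t * φ a t)
    (g := fun _ : Fin d → ℕ => (0 : ℂ))
    (bound := fun κ => (2 * π ^ 2) ^ d *
      ∏ i, blockWeight S (V i) (κ i) ^ (1 / (d : ℝ))) ?_ ?_ ?_
  · simpa using key
  · refine Summable.mul_left _ (summable_prod_pi
      (f := fun i k => blockWeight S (V i) k ^ (1 / (d : ℝ)))
      (fun i k => Real.rpow_nonneg (hw0 i k) _) fun i => ?_)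
    exact (summable_nat_add_iff 1).1 (hsum i)
  · intro κ
    rw [Metric.tendsto_nhds]
    intro ε hε
    obtain ⟨δ, hδ, hev⟩ := hsmall (ε / 2 / (2 * π ^ 2) ^ d) (by positivity)
    have hmesh : ∀ᶠ a in l, ∀ i, 2 ^ (κ i + 1) * mesh (N a i) < δ := by
      rw [eventually_all]
      intro i
      have h1 : Tendsto (fun a => N a i) l atTop :=
        tendsto_atTop.2 fun b => (tendsto_atTop.1 hN fun _ => b).mono fun a h => h i
      have h2 := (tendsto_mesh.comp h1).const_mul ((2 : ℝ) ^ (κ i + 1))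
      rw [mul_zero] at h2
      exact h2.eventually (gt_mem_nhds hδ)
    filter_upwards [hev, hmesh] with a ha hma
    rw [dist_zero_right]
    refine (norm_integral_dyadicBox_le_sup (by positivity) fun t ht => ha t fun i => ?_).trans_lt ?_
    · have := dyadicBlock_subset (mesh_pos (N a i)) (κ i) (ht i (Set.mem_univ i))
      exact ⟨this.1, this.2.trans_lt (hma i)⟩
    · rw [mul_div_cancel₀ _ hC.ne']; linarith
  · refine Eventually.of_forall fun a κ => ?_
    exact le_prod_rpow hd (norm_nonneg _) hC.le (fun i => hw0 i _) fun i =>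
      norm_integral_dyadicBox_le (N a) κ (hφ a) (hS a) i (hV a i)

/-! ### Partial sums as integrals over orthants -/

/-- The Dirichlet kernel `1 + 2 cos t + ⋯ + 2 cos (N t)`. -/
def dirichletKernel (N : ℕ) (t : ℝ) : ℝ :=
  1 + 2 * ∑ k ∈ Finset.range N, Real.cos ((k + 1) * t)

/-- The point with coordinates `± t k`. -/
def reflect {d : ℕ} (s : Fin d → Bool) (t : Fin d → ℝ) : Fin d → ℝ :=
  fun k => if s k then t k else -t k

lemma sum_exp_eq_dirichletKernel (N : ℕ) (t : ℝ) :
    ∑ n ∈ Finset.Icc (-(N : ℤ)) N, Complex.exp (Complex.I * ((n : ℂ) * (t : ℂ))) =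
      dirichletKernel N t := by
  induction N with
  | zero => simp [dirichletKernel]
  | succ N ih =>
    have := Finset.sum_Icc_succ_eq_add_endpoints
      (fun n : ℤ => Complex.exp (Complex.I * ((n : ℂ) * (t : ℂ)))) (N := N)
    push_cast at this ⊢
    rw [this, ih]
    unfold dirichletKernel
    rw [Finset.sum_range_succ]
    push_cast
    rw [Complex.cos]
    have e1 : Complex.I * (((N : ℂ) + 1) * t) = ((N + 1) * t) * Complex.I := by ring
    have e3 : Complex.I * (-((N : ℂ) + 1) * t) = -((N + 1) * t) * Complex.I := by ring
    simp only [e1, e3]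
    ring

lemma dirichletKernel_neg (N : ℕ) (t : ℝ) : dirichletKernel N (-t) = dirichletKernel N t := by
  simp [dirichletKernel]

lemma dirichletKernel_periodic (N : ℕ) : Function.Periodic (dirichletKernel N) (2 * π) := by
  intro t
  unfold dirichletKernel
  congr 2
  refine Finset.sum_congr rfl fun k _ => ?_
  have := Real.cos_add_nat_mul_two_pi ((k + 1) * t) (k + 1)
  rw [← this]; push_cast; ring_nf

lemma continuous_dirichletKernel (N : ℕ) : Continuous (dirichletKernel N) := by
  unfold dirichletKernel; fun_prop

lemma sin_half_mul_dirichletKernel (N : ℕ) (t : ℝ) :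
    Real.sin (t / 2) * dirichletKernel N t = Real.sin ((N + 1 / 2) * t) := by
  induction N with
  | zero => simp [dirichletKernel]; ring_nf
  | succ N ih =>
    unfold dirichletKernel at ih ⊢
    rw [Finset.sum_range_succ]
    have h1 : ((N + 1 : ℕ) + 1 / 2 : ℝ) * t = (N + 1) * t + t / 2 := by push_cast; ring
    have h2 : ((N : ℝ) + 1 / 2) * t = (N + 1) * t - t / 2 := by ring
    rw [h2, Real.sin_sub] at ih
    rw [h1, Real.sin_add]
    linear_combination ih

lemma halfDirichlet_eq {N : ℕ} {t : ℝ} (ht : t ∈ Set.Ioc 0 π) :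
    halfDirichlet N t = dirichletKernel N t := by
  unfold halfDirichlet cscHalf
  rw [Set.indicator_of_mem ht, ← sin_half_mul_dirichletKernel]
  have := (sin_half_pos ht.1 ht.2).ne'
  field_simp

lemma integral_halfDirichlet (N : ℕ) : ∫ t, halfDirichlet N t = π := by
  have h1 : ∫ t, halfDirichlet N t = ∫ t in Set.Ioc 0 π, dirichletKernel N t := by
    rw [← setIntegral_eq_integral_of_forall_compl_eq_zero (s := Set.Ioc 0 π)
      fun t ht => halfDirichlet_eq_zero ht]
    exact setIntegral_congr_fun measurableSet_Ioc fun t ht => halfDirichlet_eq ht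
  rw [h1, ← intervalIntegral.integral_of_le Real.pi_pos.le]
  unfold dirichletKernel
  rw [intervalIntegral.integral_add (by simp) (by
    exact Continuous.intervalIntegrable (by fun_prop) _ _),
    intervalIntegral.integral_const_mul, intervalIntegral.integral_finsetSum
      fun k _ => Continuous.intervalIntegrable (by fun_prop) _ _]
  rw [Finset.sum_eq_zero]
  · simp
  · intro k _
    have hk : (k : ℝ) + 1 ≠ 0 := by positivity
    rw [intervalIntegral.integral_comp_mul_left (fun t => Real.cos t) hk, integral_cos]
    have : Real.sin (((k : ℝ) + 1) * π) = 0 := by exact_mod_cast Real.sin_nat_mul_pi (k + 1)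
    simp [this]

lemma orthantKernel_eq_zero {d : ℕ} {N : Fin d → ℕ} {t : Fin d → ℝ}
    (ht : t ∉ Set.univ.pi fun _ : Fin d => Set.Ioc 0 π) : orthantKernel N t = 0 := by
  have : ∃ i, t i ∉ Set.Ioc 0 π := by
    by_contra hcon
    push Not at hcon
    exact ht fun i _ => hcon i
  obtain ⟨i, hi⟩ := this
  exact Finset.prod_eq_zero (Finset.mem_univ i) (by rw [halfDirichlet_eq_zero hi]; simp)

lemma setIntegral_orthantKernel_mul {d : ℕ} (N : Fin d → ℕ) (φ : (Fin d → ℝ) → ℂ) :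
    ∫ t in Set.univ.pi fun _ => Set.Ioc 0 π, orthantKernel N t * φ t =
      ∫ t in Set.univ.pi fun _ => Set.Ioi 0, orthantKernel N t * φ t := by
  symm
  refine setIntegral_eq_of_subset_of_forall_sdiff_eq_zero
    (MeasurableSet.univ_pi fun _ => measurableSet_Ioi)
    (Set.pi_mono fun _ _ => Set.Ioc_subset_Ioi_self) fun t ht => ?_
  rw [orthantKernel_eq_zero ht.2, zero_mul]

lemma integral_orthantKernel {d : ℕ} (N : Fin d → ℕ) :
    ∫ t in Set.univ.pi fun _ => Set.Ioi 0, orthantKernel N t = (π : ℂ) ^ d := by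
  have h1 : ∫ t in Set.univ.pi fun _ => Set.Ioi 0, orthantKernel N t =
      ∫ t, orthantKernel N t := by
    refine setIntegral_eq_integral_of_forall_compl_eq_zero fun t ht =>
      orthantKernel_eq_zero fun h => ht fun i hi => (h i hi).1
  rw [h1]
  unfold orthantKernel
  rw [integral_fintype_prod_volume_eq_prod fun i t => (halfDirichlet (N i) t : ℂ)]
  have h2 : ∀ i, ∫ t, (halfDirichlet (N i) t : ℂ) = π := fun i => by
    rw [integral_complex_ofReal, integral_halfDirichlet]
  simp [h2]

lemma IsPeriodic.mul {d : ℕ} {f g : (Fin d → ℝ) → ℂ} (hf : IsPeriodic f) (hg : IsPeriodic g) :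
    IsPeriodic fun x => f x * g x := fun i x => by
  simp only [hf i x, hg i x]

lemma isPeriodic_prod_dirichletKernel {d : ℕ} (N : Fin d → ℕ) (x : Fin d → ℝ) :
    IsPeriodic fun y : Fin d → ℝ => ∏ k, (dirichletKernel (N k) (x k - y k) : ℂ) := by
  intro i y
  simp only
  refine Finset.prod_congr rfl fun k _ => ?_
  by_cases h : k = i
  · subst h
    have := (dirichletKernel_periodic (N k)).sub_eq (x k - y k)
    rw [Pi.add_apply, Pi.single_eq_same, ← sub_sub, this]
  · simp [h]

/-- Basis of the period lattice. -/
def periodBasis (d : ℕ) : Module.Basis (Fin d) ℝ (Fin d → ℝ) :=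
  (Pi.basisFun ℝ (Fin d)).unitsSMul fun _ => Units.mk0 (2 * π) (by positivity)

lemma periodBasis_apply {d : ℕ} (i : Fin d) : periodBasis d i = Pi.single i (2 * π) := by
  unfold periodBasis
  rw [Module.Basis.unitsSMul_apply, Pi.basisFun_apply, Units.smul_mk0, ← Pi.single_smul]
  simp

lemma fundamentalDomain_periodBasis (d : ℕ) :
    ZSpan.fundamentalDomain (periodBasis d) = Set.univ.pi fun _ => Set.Ico 0 (2 * π) := by
  ext x
  simp only [ZSpan.mem_fundamentalDomain, Set.mem_univ_pi]
  refine forall_congr' fun i => ?_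
  unfold periodBasis
  rw [Module.Basis.repr_unitsSMul, Pi.basisFun_repr, Units.smul_def, Units.val_inv_eq_inv_val,
    Units.val_mk0, smul_eq_mul, Set.mem_Ico, Set.mem_Ico, inv_mul_eq_div,
    div_lt_one (by positivity), le_div_iff₀ (by positivity), zero_mul]

lemma IsPeriodic.vadd_eq {d : ℕ} {G : (Fin d → ℝ) → ℂ} (hG : IsPeriodic G)
    (g : Submodule.span ℤ (Set.range (periodBasis d))) (x : Fin d → ℝ) : G (g +ᵥ x) = G x := by
  obtain ⟨g, hg⟩ := g
  change G (g + x) = G x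
  have : Function.Periodic G g := by
    induction hg using Submodule.span_induction with
    | mem y hy =>
      obtain ⟨i, rfl⟩ := hy
      rw [periodBasis_apply]; exact hG i
    | zero => exact fun x => by simp
    | add y z _ _ hy hz => exact hy.add_period hz
    | smul a y _ hy => exact hy.zsmul a
  rw [add_comm]; exact this x

open scoped Pointwise in
-- Up to null sets, both domains are fundamental domains of the period lattice: the second is the
-- first translated by `x - π` in each coordinate.
lemma IsPeriodic.integral_cube_eq {d : ℕ} {G : (Fin d → ℝ) → ℂ} (hG : IsPeriodic G)
    (x : Fin d → ℝ) :
    ∫ y in cube d, G y = ∫ t in Set.univ.pi fun _ : Fin d => Set.Ioc (-π) π, G (x + t) := by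
  set F : Set (Fin d → ℝ) := Set.univ.pi fun _ => Set.Ico 0 (2 * π) with hF
  have h1 : (F : Set (Fin d → ℝ)) =ᵐ[volume] cube d := by
    exact Measure.univ_pi_Ico_ae_eq_Icc (f := fun _ : Fin d => (0 : ℝ)) (g := fun _ => 2 * π)
  have hfd := ZSpan.isAddFundamentalDomain (periodBasis d) volume
  rw [fundamentalDomain_periodBasis] at hfd
  have hfd2 := hfd.vadd_of_comm (x - fun _ => π)
  have : VAddInvariantMeasure (Submodule.span ℤ (Set.range (periodBasis d))) (Fin d → ℝ) volume :=
    inferInstanceAs <| VAddInvariantMeasure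
      (Submodule.span ℤ (Set.range (periodBasis d))).toAddSubgroup (Fin d → ℝ) volume
  have h2 := hfd.setIntegral_eq hfd2 hG.vadd_eq
  rw [← setIntegral_congr_set h1, hF, h2]
  have h3 : (x - fun _ => π) +ᵥ (Set.univ.pi fun _ : Fin d => Set.Ico 0 (2 * π)) =
      (fun t => x + t) '' (Set.univ.pi fun _ : Fin d => Set.Ico (-π) π) := by
    ext y
    simp only [Set.mem_vadd_set, Set.mem_image, Set.mem_univ_pi, vadd_eq_add]
    constructor
    · rintro ⟨t, ht, rfl⟩
      refine ⟨t - fun _ => π, fun i => ?_, by abel⟩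
      have := ht i
      simp only [Set.mem_Ico, Pi.sub_apply] at this ⊢
      constructor <;> linarith [this.1, this.2]
    · rintro ⟨t, ht, rfl⟩
      refine ⟨t + fun _ => π, fun i => ?_, by abel⟩
      have := ht i
      simp only [Set.mem_Ico, Pi.add_apply] at this ⊢
      constructor <;> linarith [this.1, this.2]
  rw [h3, (measurePreserving_add_left volume x).setIntegral_image_emb
    (measurableEmbedding_addLeft x)]
  refine setIntegral_congr_set ?_
  exact (Measure.univ_pi_Ico_ae_eq_Icc (f := fun _ : Fin d => -π) (g := fun _ => π)).trans
    (Measure.univ_pi_Ioc_ae_eq_Icc (f := fun _ : Fin d => -π) (g := fun _ => π)).symm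

lemma measurePreserving_reflect {d : ℕ} (s : Fin d → Bool) :
    MeasurePreserving (reflect s) volume volume := by
  unfold reflect
  refine volume_preserving_pi (f := fun k (t : ℝ) => if s k then t else -t) fun k => ?_
  cases s k
  · simpa using Measure.measurePreserving_neg (volume : Measure ℝ)
  · simpa [Function.id_def] using MeasurePreserving.id (volume : Measure ℝ)

lemma reflect_reflect {d : ℕ} (s : Fin d → Bool) (t : Fin d → ℝ) :
    reflect s (reflect s t) = t := by
  funext k
  unfold reflect
  cases s k <;> simp

lemma measurableEmbedding_reflect {d : ℕ} (s : Fin d → Bool) :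
    MeasurableEmbedding (reflect s) := by
  have hm := (measurePreserving_reflect s).measurable
  exact (MeasurableEquiv.mk ⟨reflect s, reflect s, reflect_reflect s, reflect_reflect s⟩
    hm hm).measurableEmbedding

lemma setIntegral_eq_sum_reflect {d : ℕ} {H : (Fin d → ℝ) → ℂ}
    (hH : IntegrableOn H (Set.univ.pi fun _ => Set.Ioc (-π) π)) :
    ∫ t in Set.univ.pi fun _ => Set.Ioc (-π) π, H t =
      ∑ s : Fin d → Bool, ∫ t in Set.univ.pi fun _ => Set.Ioc 0 π, H (reflect s t) := by
  set J : Bool → Set ℝ := fun b => if b then Set.Ioc 0 π else Set.Ioc (-π) 0 with hJ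
  have hJm : ∀ b, MeasurableSet (J b) := by
    intro b; cases b <;> simp [hJ]
  have hJU : ⋃ b, J b = Set.Ioc (-π) π := by
    rw [show ⋃ b, J b = J true ∪ J false by ext; simp [Set.mem_iUnion, or_comm]]
    simp only [hJ, if_true, Bool.false_eq_true, if_false]
    rw [Set.union_comm, Set.Ioc_union_Ioc_eq_Ioc (by linarith [Real.pi_pos]) Real.pi_pos.le]
  have hU : (Set.univ.pi fun _ : Fin d => Set.Ioc (-π) π) =
      ⋃ s : Fin d → Bool, Set.univ.pi fun k => J (s k) := by
    rw [Set.iUnion_univ_pi fun (_ : Fin d) b => J b, hJU]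
  rw [hU] at hH ⊢
  rw [integral_iUnion_fintype (fun s => MeasurableSet.univ_pi fun k => hJm _) ?_
    fun s => hH.mono_set (Set.subset_iUnion (fun s => Set.univ.pi fun k : Fin d => J (s k)) s)]
  · refine Finset.sum_congr rfl fun s _ => ?_
    rw [← (measurePreserving_reflect s).setIntegral_preimage_emb (measurableEmbedding_reflect s)]
    -- Reflection turns `(-π, 0]` into `[0, π)`, which agrees with `(0, π]` only almost everywhere.
    refine setIntegral_congr_set ?_
    have : reflect s ⁻¹' (Set.univ.pi fun k => J (s k)) =
        Set.univ.pi fun k => if s k then Set.Ioc 0 π else Set.Ico 0 π := by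
      ext t
      simp only [Set.mem_preimage, Set.mem_univ_pi]
      refine forall_congr' fun k => ?_
      simp only [reflect, hJ]
      cases s k
      · simp only [Bool.false_eq_true, if_false, Set.mem_Ioc, Set.mem_Ico]
        constructor <;> rintro ⟨h1, h2⟩ <;> constructor <;> linarith
      · simp
    rw [this, volume_pi]
    refine Measure.ae_eq_set_pi fun k _ => ?_
    cases s k
    · simpa using Ico_ae_eq_Ioc
    · exact ae_of_all _ fun _ => rfl
  · intro s s' hne
    obtain ⟨k, hk⟩ := Function.ne_iff.1 hne
    refine Set.disjoint_left.2 fun t ht ht' => ?_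
    have h1 := ht k (Set.mem_univ k)
    have h2 := ht' k (Set.mem_univ k)
    revert hk h1 h2
    simp only [hJ]
    cases s k <;> cases s' k <;> simp
    · intros; linarith
    · intros; linarith

lemma rectPartialSum_eq_integral {d : ℕ} {f : (Fin d → ℝ) → ℂ} (hf : IntegrableOn f (cube d))
    (N : Fin d → ℕ) (x : Fin d → ℝ) :
    rectPartialSum N f x = (1 / (2 * (π : ℂ)) ^ d) *
      ∫ y in cube d, f y * ∏ k, (dirichletKernel (N k) (x k - y k) : ℂ) := by
  have h1 : ∀ y : Fin d → ℝ, ∏ k, (dirichletKernel (N k) (x k - y k) : ℂ) =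
      ∑ n ∈ Fintype.piFinset (fun k => Finset.Icc (-(N k : ℤ)) (N k : ℤ)),
        Complex.exp (-(Complex.I * ∑ k, (n k : ℂ) * (y k : ℂ))) *
          Complex.exp (Complex.I * ∑ k, (n k : ℂ) * (x k : ℂ)) := by
    intro y
    simp only [← sum_exp_eq_dirichletKernel]
    rw [Finset.prod_univ_sum]
    refine Finset.sum_congr rfl fun n _ => ?_
    rw [← Complex.exp_add, ← Complex.exp_sum]
    congr 1
    rw [neg_add_eq_sub, ← mul_sub, ← Finset.sum_sub_distrib, Finset.mul_sum]
    refine Finset.sum_congr rfl fun k _ => ?_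
    push_cast; ring
  unfold rectPartialSum fourierCoefficient
  simp only [h1, Finset.mul_sum]
  rw [integral_finsetSum, Finset.mul_sum]
  · refine Finset.sum_congr rfl fun n _ => ?_
    rw [mul_assoc, ← integral_mul_const]
    simp only [mul_assoc]
  · intro n _
    have hc : Continuous fun y : Fin d → ℝ =>
        Complex.exp (-(∑ k, Complex.I * ((n k : ℂ) * (y k : ℂ)))) *
          Complex.exp (∑ k, Complex.I * ((n k : ℂ) * (x k : ℂ))) := by fun_prop
    exact hf.mul_continuousOn hc.continuousOn isCompact_Icc

theorem rectPartialSum_eq_sum_orthants {d : ℕ} {f : (Fin d → ℝ) → ℂ} (hf : f ∈ L1 d)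
    (hfm : AEStronglyMeasurable f) {S : ℝ}
    (hS : ∀ x, ‖f x‖ ≤ S) (N : Fin d → ℕ) (x : Fin d → ℝ) :
    rectPartialSum N f x = (1 / (2 * (π : ℂ)) ^ d) * ∑ s : Fin d → Bool,
      ∫ t in Set.univ.pi fun _ => Set.Ioi 0, orthantKernel N t * f (x + reflect s t) := by
  rw [rectPartialSum_eq_integral hf.2,
    (hf.1.mul (isPeriodic_prod_dirichletKernel N x)).integral_cube_eq x]
  congr 1
  have hint : IntegrableOn (fun t : Fin d → ℝ => f (x + t) *
      ∏ k, (dirichletKernel (N k) (x k - (x + t) k) : ℂ))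
      (Set.univ.pi fun _ => Set.Ioc (-π) π) := by
    have hsub : (Set.univ.pi fun _ : Fin d => Set.Ioc (-π) π) ⊆
        Set.Icc (fun _ => -π) (fun _ => π) := fun t ht =>
      ⟨fun k => (ht k (Set.mem_univ k)).1.le, fun k => (ht k (Set.mem_univ k)).2⟩
    refine IntegrableOn.mono_set ?_ hsub
    have h1 : IntegrableOn (fun t => f (x + t)) (Set.Icc (fun _ => -π) (fun _ => π)) :=
      Measure.integrableOn_of_bounded (M := S) isCompact_Icc.measure_lt_top.ne
        (hfm.comp_measurePreserving (measurePreserving_add_left volume x))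
        (Eventually.of_forall fun t => hS _)
    have hc : Continuous fun t : Fin d → ℝ =>
        ∏ k, (dirichletKernel (N k) (x k - (x + t) k) : ℂ) := by
      refine continuous_finsetProd _ fun k _ => ?_
      have := continuous_dirichletKernel (N k)
      fun_prop
    exact h1.mul_continuousOn hc.continuousOn isCompact_Icc
  rw [setIntegral_eq_sum_reflect hint]
  refine Finset.sum_congr rfl fun s _ => ?_
  rw [← setIntegral_orthantKernel_mul]
  refine setIntegral_congr_fun (MeasurableSet.univ_pi fun _ => measurableSet_Ioc) fun t ht => ?_
  rw [mul_comm]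
  congr 1
  unfold orthantKernel
  refine Finset.prod_congr rfl fun k _ => ?_
  rw [halfDirichlet_eq (ht k (Set.mem_univ k)), Pi.add_apply, sub_add_cancel_left,
    dirichletKernel_neg]
  unfold reflect
  cases s k
  · simp [dirichletKernel_neg]
  · simp

/-! ### The modulus of variation over an arbitrary period -/

lemma IsPeriodic.eq_of_congr {d : ℕ} {f : (Fin d → ℝ) → ℂ} (hf : IsPeriodic f)
    {x y : Fin d → ℝ} (h : ∀ k, ∃ m : ℤ, x k = y k + m * (2 * π)) : f x = f y := by
  choose m hm using h
  have hp : ∀ s : Finset (Fin d),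
      Function.Periodic f (∑ k ∈ s, m k • (Pi.single k (2 * π) : Fin d → ℝ)) := by
    intro s
    induction s using Finset.induction_on with
    | empty => intro x; simp
    | insert a s ha ih =>
      rw [Finset.sum_insert ha]
      exact ((hf a).zsmul (m a)).add_period ih
  rw [← hp Finset.univ y]
  congr 1
  funext k
  rw [hm k, Pi.add_apply, Finset.sum_apply, Finset.sum_eq_single k]
  · simp
  · intro j _ hj
    simp [Ne.symm hj]
  · simp

lemma exists_mem_cube_congr {d : ℕ} (x : Fin d → ℝ) :
    ∃ y ∈ cube d, ∀ k, ∃ m : ℤ, x k = y k + m * (2 * π) := by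
  have hpi : 0 < 2 * π := by positivity
  refine ⟨fun k => toIcoMod hpi 0 (x k), ⟨fun k => ?_, fun k => ?_⟩, fun k => ?_⟩
  · exact (toIcoMod_mem_Ico hpi 0 (x k)).1
  · have := (toIcoMod_mem_Ico hpi 0 (x k)).2; simp only [zero_add] at this; exact this.le
  · refine ⟨toIcoDiv hpi 0 (x k), ?_⟩
    have := toIcoMod_add_toIcoDiv_zsmul hpi 0 (x k)
    rw [zsmul_eq_mul] at this
    exact this.symm

lemma IsPeriodic.update_congr {d : ℕ} {f : (Fin d → ℝ) → ℂ} (hf : IsPeriodic f)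
    {x y : Fin d → ℝ} (h : ∀ k, ∃ m : ℤ, x k = y k + m * (2 * π)) (i : Fin d) {t u : ℝ} (m : ℤ)
    (htu : t = u + m * (2 * π)) : f (Function.update x i t) = f (Function.update y i u) := by
  refine hf.eq_of_congr fun k => ?_
  by_cases hk : k = i
  · subst hk; exact ⟨m, by simpa using htu⟩
  · simpa [hk] using h k

lemma sum_enorm_le_partialModulus {d n : ℕ} (f : (Fin d → ℝ) → ℂ) (i : Fin d) {x : Fin d → ℝ}
    (hx : x ∈ cube d) {I : Fin n → ℝ × ℝ} (hI : I ∈ Omega n) :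
    ∑ j : Fin n, ‖f (Function.update x i (I j).2) - f (Function.update x i (I j).1)‖ₑ ≤
      partialModulus i n f :=
  le_iSup₂_of_le x hx (le_iSup₂_of_le I hI le_rfl)

lemma enorm_sub_le_partialModulus_one {d : ℕ} (f : (Fin d → ℝ) → ℂ) (i : Fin d) {x : Fin d → ℝ}
    (hx : x ∈ cube d) {a b : ℝ} (ha : 0 ≤ a) (hab : a < b) (hb : b ≤ 2 * π) :
    ‖f (Function.update x i b) - f (Function.update x i a)‖ₑ ≤ partialModulus i 1 f := by
  have : (fun _ : Fin 1 => (a, b)) ∈ Omega 1 :=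
    ⟨fun _ => ⟨ha, hab, hb⟩, fun j k hjk => absurd (Subsingleton.elim j k) hjk⟩
  simpa using sum_enorm_le_partialModulus f i hx this

/-- The modulus only sees intervals inside `[0, 2π]`. A window of length `2π` starting at `c`
contains a multiple `P` of `2π`; cutting there and translating both parts back is free, except for
the at most one interval straddling `P`, whose right piece costs the extra `partialModulus i 1 f`.
-/
lemma IsPeriodic.sum_enorm_le {d n : ℕ} {f : (Fin d → ℝ) → ℂ} (hf : IsPeriodic f) (i : Fin d)
    (x : Fin d → ℝ) {c : ℝ} {a b : Fin n → ℝ} (hab : ∀ j, a j < b j) (ha : ∀ j, c ≤ a j)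
    (hb : ∀ j, b j ≤ c + 2 * π)
    (hdisj : ∀ j k, j ≠ k → Disjoint (Set.Ioo (a j) (b j)) (Set.Ioo (a k) (b k))) :
    ∑ j, ‖f (Function.update x i (b j)) - f (Function.update x i (a j))‖ₑ ≤
      partialModulus i n f + partialModulus i 1 f := by
  classical
  obtain ⟨y, hy, hxy⟩ := exists_mem_cube_congr x
  have hpi : 0 < 2 * π := by positivity
  obtain ⟨m, hm1, hm2⟩ : ∃ m : ℤ, c ≤ m * (2 * π) ∧ m * (2 * π) ≤ c + 2 * π := by
    refine ⟨⌈c / (2 * π)⌉, ?_, ?_⟩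
    · have := Int.le_ceil (c / (2 * π))
      rwa [div_le_iff₀ hpi] at this
    · have := (Int.ceil_lt_add_one (c / (2 * π))).le
      have h2 := mul_le_mul_of_nonneg_right this hpi.le
      rwa [add_mul, div_mul_cancel₀ _ hpi.ne', one_mul] at h2
  set P : ℝ := m * (2 * π) with hP
  -- The straddling interval keeps only its part left of `P`. Below, `σ` counts the periods by which
  -- each interval is moved back; the two groups land on either side of `c + 2π - P`, so they stay
  -- disjoint.
  set b' : Fin n → ℝ := fun j => if a j < P ∧ P < b j then P else b j with hb'
  set σ : Fin n → ℤ := fun j => if b' j ≤ P then m - 1 else m with hσ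
  have hab' : ∀ j, a j < b' j := by
    intro j; simp only [hb']; split_ifs with h
    · exact h.1
    · exact hab j
  have hb'b : ∀ j, b' j ≤ b j := by
    intro j; simp only [hb']; split_ifs with h
    · exact h.2.le
    · exact le_rfl
  have hside : ∀ j, ¬ b' j ≤ P → P ≤ a j := by
    intro j; simp only [hb']; split_ifs with h
    · intro h'; exact absurd le_rfl h'
    · intro h'; by_contra hcon
      exact h ⟨not_le.1 hcon, not_le.1 h'⟩
  have hdisj' : ∀ j k, j ≠ k → Disjoint (Set.Ioo (a j) (b' j)) (Set.Ioo (a k) (b' k)) :=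
    fun j k hjk => (hdisj j k hjk).mono (Set.Ioo_subset_Ioo_right (hb'b j))
      (Set.Ioo_subset_Ioo_right (hb'b k))
  have hshift : ∀ j, (σ j : ℝ) * (2 * π) = if b' j ≤ P then P - 2 * π else P := by
    intro j; simp only [hσ]; split_ifs
    · push_cast; rw [hP]; ring
    · rfl
  have hI : (fun j => (a j - σ j * (2 * π), b' j - σ j * (2 * π))) ∈ Omega n := by
    refine ⟨fun j => ?_, fun j k hjk => ?_⟩
    · simp only [hshift]
      have h1 := ha j; have h2 := hab' j; have h3 := (hb'b j).trans (hb j)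
      split_ifs with h
      · refine ⟨?_, ?_, ?_⟩ <;> linarith
      · have h4 := hside j h
        refine ⟨?_, ?_, ?_⟩ <;> linarith
    · refine Set.disjoint_left.2 fun t ht ht' => ?_
      simp only [hshift, Set.mem_Ioo] at ht ht'
      have hj := (hb'b j).trans (hb j)
      have hk := (hb'b k).trans (hb k)
      have haj := ha j
      have hak := ha k
      split_ifs at ht ht' with h1 h2 h2
      · exact Set.disjoint_left.1 (hdisj' j k hjk)
          (show t + (P - 2 * π) ∈ Set.Ioo _ _ from ⟨by linarith [ht.1], by linarith [ht.2]⟩)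
          ⟨by linarith [ht'.1], by linarith [ht'.2]⟩
      · linarith [ht.1, ht'.2]
      · linarith [ht.2, ht'.1]
      · exact Set.disjoint_left.1 (hdisj' j k hjk)
          (show t + P ∈ Set.Ioo _ _ from ⟨by linarith [ht.1], by linarith [ht.2]⟩)
          ⟨by linarith [ht'.1], by linarith [ht'.2]⟩
  have hsum1 : ∑ j, ‖f (Function.update x i (b' j)) - f (Function.update x i (a j))‖ₑ ≤
      partialModulus i n f := by
    refine le_trans (le_of_eq ?_) (sum_enorm_le_partialModulus f i hy hI)
    refine Finset.sum_congr rfl fun j _ => ?_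
    rw [hf.update_congr hxy i (t := b' j) (u := b' j - σ j * (2 * π)) (σ j) (by ring),
      hf.update_congr hxy i (t := a j) (u := a j - σ j * (2 * π)) (σ j) (by ring)]
  have hsum2 : ∑ j, ‖f (Function.update x i (b j)) - f (Function.update x i (b' j))‖ₑ ≤
      partialModulus i 1 f := by
    by_cases hex : ∃ j, a j < P ∧ P < b j
    · obtain ⟨j₀, hj₀⟩ := hex
      rw [Finset.sum_eq_single j₀]
      · have e : b' j₀ = P := by simp only [hb']; rw [if_pos hj₀]
        rw [e, hf.update_congr hxy i (t := b j₀) (u := b j₀ - P) m (by ring),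
          hf.update_congr hxy i (t := P) (u := 0) m (by rw [hP]; ring)]
        exact enorm_sub_le_partialModulus_one f i hy le_rfl (by linarith [hj₀.2])
          (by linarith [hb j₀])
      · intro j _ hj
        have e : b' j = b j := by
          simp only [hb']
          rw [if_neg]
          intro h
          exact Set.disjoint_left.1 (hdisj j j₀ hj) (show P ∈ Set.Ioo _ _ from h) hj₀
        simp [e]
      · simp
    · push Not at hex
      rw [Finset.sum_eq_zero]
      · exact zero_le
      · intro j _
        have e : b' j = b j := by
          simp only [hb']
          rw [if_neg]
          intro h
          exact absurd h.2 (not_lt.2 (hex j h.1))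
        simp [e]
  refine le_trans ?_ (add_le_add hsum1 hsum2)
  rw [← Finset.sum_add_distrib]
  refine Finset.sum_le_sum fun j _ => ?_
  rw [add_comm]
  refine le_trans (le_of_eq ?_) (enorm_add_le _ _)
  congr 1; ring

lemma IsPeriodic.enorm_sub_le {d : ℕ} {f : (Fin d → ℝ) → ℂ} (hf : IsPeriodic f) (i : Fin d)
    (x : Fin d → ℝ) (t u : ℝ) :
    ‖f (Function.update x i t) - f (Function.update x i u)‖ₑ ≤ partialModulus i 1 f := by
  obtain ⟨y, hy, hxy⟩ := exists_mem_cube_congr x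
  have hpi : 0 < 2 * π := by positivity
  have red : ∀ t : ℝ, f (Function.update x i t) = f (Function.update y i (toIcoMod hpi 0 t)) := by
    intro t
    refine hf.update_congr hxy i (toIcoDiv hpi 0 t) ?_
    have := toIcoMod_add_toIcoDiv_zsmul hpi 0 t
    rw [zsmul_eq_mul] at this
    exact this.symm
  have hmem : ∀ t : ℝ, 0 ≤ toIcoMod hpi 0 t ∧ toIcoMod hpi 0 t ≤ 2 * π := fun t =>
    ⟨(toIcoMod_mem_Ico hpi 0 t).1, by
      have := (toIcoMod_mem_Ico hpi 0 t).2; rw [zero_add] at this; exact this.le⟩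
  rw [red t, red u]
  rcases lt_trichotomy (toIcoMod hpi 0 t) (toIcoMod hpi 0 u) with h | h | h
  · rw [← enorm_neg, neg_sub]
    exact enorm_sub_le_partialModulus_one f i hy (hmem t).1 h (hmem u).2
  · simp [h]
  · exact enorm_sub_le_partialModulus_one f i hy (hmem u).1 h (hmem t).2

/-! ### Consequences of the summability condition -/

lemma partialModulus_ne_top {d : ℕ} (hd : 0 < d) {f : (Fin d → ℝ) → ℂ} (hf : f ∈ modulusClass d)
    (i : Fin d) (k : ℕ) : partialModulus i (2 ^ k) f ≠ ∞ := by
  intro htop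
  have h := ENNReal.ne_top_of_tsum_ne_top (hf.2.2 i).ne k
  rw [htop, ENNReal.top_rpow_of_pos (by positivity), ENNReal.top_div_of_ne_top] at h
  · exact h rfl
  · exact ENNReal.rpow_ne_top_of_nonneg (by positivity) (by simp)

lemma summable_modulus {d : ℕ} {f : (Fin d → ℝ) → ℂ} (hf : f ∈ modulusClass d)
    (i : Fin d) :
    Summable fun k : ℕ => ((partialModulus i (2 ^ k) f).toReal / 2 ^ k) ^ (1 / (d : ℝ)) := by
  have h := ENNReal.summable_toReal (hf.2.2 i).ne
  refine h.congr fun k => ?_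
  rw [ENNReal.toReal_div, ← ENNReal.toReal_rpow, ← ENNReal.toReal_rpow,
    Real.div_rpow ENNReal.toReal_nonneg (by positivity)]
  congr 1
  rw [← Real.rpow_natCast, ← Real.rpow_mul (by norm_num), mul_one_div]
  simp

/-- Subadditivity of `y ↦ y ^ (1/d)` splits off the constant, which contributes a geometric series.
This absorbs the sup bound and the extra `partialModulus i 1 f`. -/
lemma summable_modulus_add {d : ℕ} (hd : 0 < d) {f : (Fin d → ℝ) → ℂ} (hf : f ∈ modulusClass d)
    (i : Fin d) {C : ℝ} (hC : 0 ≤ C) :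
    Summable fun k : ℕ =>
      (((partialModulus i (2 ^ k) f).toReal + C) / 2 ^ k) ^ (1 / (d : ℝ)) := by
  have hd1 : (1 : ℝ) ≤ d := by exact_mod_cast hd
  have hgeo : Summable fun k : ℕ => C ^ (1 / (d : ℝ)) * ((1 / 2 : ℝ) ^ (1 / (d : ℝ))) ^ k :=
    (summable_geometric_of_lt_one (by positivity)
      (Real.rpow_lt_one (by norm_num) (by norm_num) (by positivity))).mul_left _
  refine Summable.of_nonneg_of_le (fun k => by positivity) (fun k => ?_)
    ((summable_modulus hf i).add hgeo)
  rw [add_div]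
  refine (Real.rpow_add_le_add_rpow (by positivity) (by positivity) (by positivity)
    (by rw [div_le_one (by positivity)]; exact hd1)).trans (le_of_eq ?_)
  congr 1
  rw [Real.div_rpow hC (by positivity), div_eq_mul_inv]
  congr 1
  rw [← Real.rpow_natCast, ← Real.rpow_natCast, ← Real.rpow_mul (by norm_num),
    ← Real.rpow_mul (by norm_num), mul_comm, Real.div_rpow (by norm_num) (by norm_num)]
  simp

/-- Moving from `0` to `x` one coordinate at a time changes `f` by at most `partialModulus i 1 f` at
each step, and this is finite as the `j = 0` modulus of the series. -/
lemma exists_norm_le {d : ℕ} (hd : 0 < d) {f : (Fin d → ℝ) → ℂ} (hf : f ∈ modulusClass d) :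
    ∃ S : ℝ, ∀ x, ‖f x‖ ≤ S := by
  have hstep : ∀ i (x : Fin d → ℝ) (t u : ℝ),
      ‖f (Function.update x i t) - f (Function.update x i u)‖ ≤
        (partialModulus i 1 f).toReal := by
    intro i x t u
    have := ENNReal.toReal_mono (by simpa using partialModulus_ne_top hd hf i 0)
      (hf.2.1.enorm_sub_le i x t u)
    simpa using this
  refine ⟨‖f 0‖ + ∑ i, (partialModulus i 1 f).toReal, fun x => ?_⟩
  have key : ∀ s : Finset (Fin d),
      ‖f (s.piecewise x 0) - f 0‖ ≤ ∑ i ∈ s, (partialModulus i 1 f).toReal := by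
    intro s
    induction s using Finset.induction_on with
    | empty => simp
    | insert i s hi ih =>
      rw [Finset.sum_insert hi, Finset.piecewise_insert]
      have h1 := hstep i (s.piecewise x 0) (x i) (s.piecewise x 0 i)
      rw [Function.update_eq_self] at h1
      calc _ ≤ _ := norm_sub_le_norm_sub_add_norm_sub _ (f (s.piecewise x 0)) _
        _ ≤ _ := add_le_add h1 ih
  have h := key Finset.univ
  rw [Finset.piecewise_univ] at h
  calc ‖f x‖ = ‖f 0 + (f x - f 0)‖ := by congr 1; ring
    _ ≤ _ := (norm_add_le _ _).trans (by gcongr)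

lemma modulusClass_subset_L1 {d : ℕ} (hd : 0 < d) : modulusClass d ⊆ L1 d := by
  intro f hf
  obtain ⟨S, hS⟩ := exists_norm_le hd hf
  exact ⟨hf.2.1, Measure.integrableOn_of_bounded (M := S) isCompact_Icc.measure_lt_top.ne
    hf.1.aestronglyMeasurable (Eventually.of_forall hS)⟩

lemma add_reflect_update {d : ℕ} (x : Fin d → ℝ) (s : Fin d → Bool) (t : Fin d → ℝ) (i : Fin d)
    (p : ℝ) : x + reflect s (Function.update t i p) =
      Function.update (x + reflect s t) i (if s i then x i + p else x i - p) := by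
  funext k
  by_cases hk : k = i
  · subst hk
    cases h : s k <;> simp [reflect, h, sub_eq_add_neg]
  · simp [reflect, hk]

lemma sum_norm_sub_add_reflect_le {d : ℕ} (hd : 0 < d) {f : (Fin d → ℝ) → ℂ}
    (hf : f ∈ modulusClass d) (y : Fin d → ℝ) (s : Fin d → Bool) (i : Fin d) (x : Fin d → ℝ)
    (k : ℕ) {t h : ℝ} (hh : 0 < h) (hth : t + 2 ^ (k + 1) * h ≤ 2 * π + h) (ht : 0 ≤ t) :
    ∑ j ∈ Finset.range (2 ^ k), ‖f (y + reflect s (Function.update x i (t + 2 * j * h))) -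
      f (y + reflect s (Function.update x i (t + 2 * j * h + h)))‖ ≤
      (partialModulus i (2 ^ k) f).toReal + (partialModulus i 1 f).toReal := by
  have hv : partialModulus i (2 ^ k) f ≠ ∞ := partialModulus_ne_top hd hf i k
  have hv1 : partialModulus i 1 f ≠ ∞ := by simpa using partialModulus_ne_top hd hf i 0
  rw [← ENNReal.toReal_add hv hv1, Finset.sum_range]
  simp only [add_reflect_update]
  have hp0 : ∀ j : Fin (2 ^ k), 0 ≤ t + 2 * (j : ℕ) * h := fun j => by positivity
  have hp1 : ∀ j : Fin (2 ^ k), t + 2 * (j : ℕ) * h + h ≤ 2 * π := by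
    intro j
    have h1 : ((j : ℕ) : ℝ) + 1 ≤ 2 ^ k := by exact_mod_cast j.2
    have h2 := mul_le_mul_of_nonneg_right h1 hh.le
    rw [pow_succ] at hth
    linarith
  have hsep : ∀ j j' : Fin (2 ^ k), j < j' →
      t + 2 * (j : ℕ) * h + h ≤ t + 2 * (j' : ℕ) * h := by
    intro j j' hjj
    have h1 : ((j : ℕ) : ℝ) + 1 ≤ (j' : ℕ) := by exact_mod_cast hjj
    have h2 := mul_le_mul_of_nonneg_right h1 hh.le
    linarith
  have fin : ∀ F : Fin (2 ^ k) → ℂ, ∑ j, ‖F j‖ₑ ≤ partialModulus i (2 ^ k) f +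
      partialModulus i 1 f → ∑ j, ‖F j‖ ≤
        (partialModulus i (2 ^ k) f + partialModulus i 1 f).toReal := by
    intro F hF
    have := ENNReal.toReal_mono (ENNReal.add_ne_top.2 ⟨hv, hv1⟩) hF
    rw [ENNReal.toReal_sum fun j _ => enorm_ne_top] at this
    simpa using this
  refine fin _ ?_
  -- The sign decides on which side of `y i` the window of length `2π` lies; for `-` the endpoints
  -- also swap roles.
  cases hs : s i
  · simp only [Bool.false_eq_true, if_false]
    refine hf.2.1.sum_enorm_le i (y + reflect s x) (c := y i - 2 * π)
      (a := fun j => y i - (t + 2 * (j : ℕ) * h + h)) (b := fun j => y i - (t + 2 * (j : ℕ) * h))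
      (fun j => by linarith) (fun j => by linarith [hp1 j]) (fun j => by linarith [hp0 j])
      fun j j' hjj => ?_
    refine Set.disjoint_left.2 fun u hu hu' => ?_
    rcases lt_or_gt_of_ne hjj with h1 | h1
    · linarith [hsep _ _ h1, hu.1, hu'.2]
    · linarith [hsep _ _ h1, hu'.1, hu.2]
  · simp only [if_true]
    refine le_trans (le_of_eq (Finset.sum_congr rfl fun j _ => ?_))
      (hf.2.1.sum_enorm_le i (y + reflect s x) (c := y i)
      (a := fun j : Fin (2 ^ k) => y i + (t + 2 * (j : ℕ) * h))
      (b := fun j => y i + (t + 2 * (j : ℕ) * h + h))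
      (fun j => by linarith) (fun j => by linarith [hp0 j]) (fun j => by linarith [hp1 j])
      fun j j' hjj => ?_)
    · rw [← enorm_neg, neg_sub]
    refine Set.disjoint_left.2 fun u hu hu' => ?_
    rcases lt_or_gt_of_ne hjj with h1 | h1
    · linarith [hsep _ _ h1, hu.2, hu'.1]
    · linarith [hsep _ _ h1, hu'.2, hu.1]

/-! ### Convergence of the partial sums -/

theorem tendsto_rectPartialSum_sub_mean {ι : Type*} {l : Filter ι} {d : ℕ} (hd : 0 < d)
    {f : (Fin d → ℝ) → ℂ} (hf : f ∈ modulusClass d) {N : ι → Fin d → ℕ}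
    (hN : Tendsto N l atTop) (x : ι → Fin d → ℝ) (L : ι → (Fin d → Bool) → ℂ) {B : ℝ}
    (hL : ∀ a s, ‖L a s‖ ≤ B)
    (hsmall : ∀ s, ∀ ε > 0, ∃ δ > 0, ∀ᶠ a in l, ∀ t : Fin d → ℝ, (∀ i, 0 < t i ∧ t i < δ) →
      ‖f (x a + reflect s t) - L a s‖ ≤ ε) :
    Tendsto (fun a => rectPartialSum (N a) f (x a) - (1 / (2 : ℂ) ^ d) * ∑ s, L a s) l (𝓝 0) := by
  obtain ⟨S, hS⟩ := exists_norm_le hd hf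
  have hfm := hf.1.aestronglyMeasurable
  have hcomp : ∀ a s, AEStronglyMeasurable (fun t => f (x a + reflect s t)) := fun a s =>
    hfm.comp_measurePreserving
      ((measurePreserving_add_left volume (x a)).comp (measurePreserving_reflect s))
  have hpi : (π : ℂ) ≠ 0 := by exact_mod_cast Real.pi_ne_zero
  have hrep : ∀ a, rectPartialSum (N a) f (x a) - (1 / (2 : ℂ) ^ d) * ∑ s, L a s =
      (1 / (2 * (π : ℂ)) ^ d) * ∑ s : Fin d → Bool, ∫ t in Set.univ.pi fun _ => Set.Ioi 0,
        orthantKernel (N a) t * (f (x a + reflect s t) - L a s) := by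
    intro a
    rw [rectPartialSum_eq_sum_orthants (modulusClass_subset_L1 hd hf) hfm hS]
    have e : ∀ s : Fin d → Bool, ∫ t in Set.univ.pi fun _ => Set.Ioi 0,
        orthantKernel (N a) t * (f (x a + reflect s t) - L a s) =
        (∫ t in Set.univ.pi fun _ => Set.Ioi 0, orthantKernel (N a) t * f (x a + reflect s t)) -
          (π : ℂ) ^ d * L a s := by
      intro s
      simp only [mul_sub]
      rw [integral_sub, integral_mul_const, integral_orthantKernel]
      · exact ((integrable_orthantKernel (N a)).mul_bdd (hcomp a s)
          (Eventually.of_forall fun t => hS _)).integrableOn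
      · exact ((integrable_orthantKernel (N a)).mul_const _).integrableOn
    simp only [e]
    rw [Finset.sum_sub_distrib, mul_sub, ← Finset.mul_sum]
    congr 1
    rw [mul_pow]
    field_simp
  simp only [hrep]
  have hlim : ∀ s : Fin d → Bool, Tendsto (fun a => ∫ t in Set.univ.pi fun _ => Set.Ioi 0,
      orthantKernel (N a) t * (f (x a + reflect s t) - L a s)) l (𝓝 0) := by
    intro s
    have hb : ∀ a t, ‖f (x a + reflect s t) - L a s‖ ≤ |S| + |B| := fun a t =>
      (norm_sub_le _ _).trans (add_le_add ((hS _).trans (le_abs_self _))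
        ((hL a s).trans (le_abs_self _)))
    refine tendsto_integral_orthantKernel hd hN
      (φ := fun a t => f (x a + reflect s t) - L a s)
      (fun a => (hcomp a s).sub aestronglyMeasurable_const) (S := |S| + |B|) (by positivity) hb
      (V := fun i k => (partialModulus i (2 ^ k) f).toReal + (partialModulus i 1 f).toReal)
      (fun i k => by positivity) (fun i => ?_) (fun a i y k t h hh hth ht => ?_) (hsmall s)
    · simpa only [add_assoc] using summable_modulus_add hd hf i
        (C := (partialModulus i 1 f).toReal + (|S| + |B|)) (by positivity)
    · simpa only [sub_sub_sub_cancel_right] using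
        sum_norm_sub_add_reflect_le hd hf (x a) s i y k hh hth ht
  have := (tendsto_finsetSum Finset.univ fun s _ => hlim s).const_mul (1 / (2 * (π : ℂ)) ^ d)
  simpa using this

lemma add_reflect_mem_orthant {d : ℕ} {x t : Fin d → ℝ} (s : Fin d → Bool) (ht : ∀ i, 0 < t i) :
    x + reflect s t ∈ orthant x s := by
  intro k
  have := ht k
  cases h : s k <;> simpa [reflect, h] using this

lemma dist_add_reflect_lt {d : ℕ} {x t : Fin d → ℝ} (s : Fin d → Bool) {δ : ℝ} (hδ : 0 < δ)
    (ht : ∀ i, 0 < t i ∧ t i < δ) : dist (x + reflect s t) x < δ := by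
  rw [dist_self_add_left, pi_norm_lt_iff hδ]
  intro i
  have h1 : ‖reflect s t i‖ = |t i| := by
    unfold reflect
    cases s i <;> simp
  rw [h1, abs_of_pos (ht i).1]
  exact (ht i).2

/-- Needed for uniqueness of the orthant limits, hence to evaluate `limUnder` in `fStar`. -/
lemma nhdsWithin_orthant_neBot {d : ℕ} (x : Fin d → ℝ) (s : Fin d → Bool) :
    (𝓝[orthant x s] x).NeBot := by
  rw [← mem_closure_iff_nhdsWithin_neBot, Metric.mem_closure_iff]
  intro ε hε
  refine ⟨x + reflect s fun _ => ε / 2, add_reflect_mem_orthant s fun _ => by positivity, ?_⟩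
  rw [dist_comm]
  exact dist_add_reflect_lt s hε fun _ => ⟨by positivity, by linarith⟩

lemma tendsto_rectPartialSum_of_isRegularPoint {d : ℕ} (hd : 0 < d) {f : (Fin d → ℝ) → ℂ}
    (hf : f ∈ modulusClass d) {x : Fin d → ℝ} (hx : IsRegularPoint f x) :
    Tendsto (fun N : Fin d → ℕ => rectPartialSum N f x) atTop (𝓝 (fStar f x)) := by
  choose L hL using hx
  have hstar : fStar f x = (1 / (2 : ℂ) ^ d) * ∑ s, L s := by
    unfold fStar
    congr 1
    refine Finset.sum_congr rfl fun s _ => ?_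
    have := nhdsWithin_orthant_neBot x s
    exact (hL s).limUnder_eq
  have key := tendsto_rectPartialSum_sub_mean hd hf (N := id) tendsto_id (fun _ => x)
    (fun _ => L) (B := ∑ s, ‖L s‖)
    (fun _ s => Finset.single_le_sum (f := fun s => ‖L s‖) (fun _ _ => norm_nonneg _)
      (Finset.mem_univ s)) fun s ε hε => ?_
  · rw [hstar, ← tendsto_sub_nhds_zero_iff]
    exact key
  · obtain ⟨δ, hδ, h⟩ := Metric.tendsto_nhdsWithin_nhds.1 (hL s) ε hε
    refine ⟨δ, hδ, Eventually.of_forall fun _ t ht => ?_⟩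
    rw [← dist_eq_norm]
    exact (h (add_reflect_mem_orthant s fun i => (ht i).1) (dist_add_reflect_lt s hδ ht)).le

lemma tendstoUniformlyOn_rectPartialSum {d : ℕ} (hd : 0 < d) {f : (Fin d → ℝ) → ℂ}
    (hf : f ∈ modulusClass d) {K U : Set (Fin d → ℝ)} (hK : IsCompact K) (hU : IsOpen U)
    (hKU : K ⊆ U) (hfU : ContinuousOn f U) :
    TendstoUniformlyOn (fun (N : Fin d → ℕ) (x : Fin d → ℝ) => rectPartialSum N f x) f atTop K := by
  obtain ⟨S, hS⟩ := exists_norm_le hd hf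
  -- Convergence along `atTop ×ˢ 𝓟 K` is uniform convergence on `K`; all `2^d` limits are taken to
  -- be `f` at the moving point.
  have key := tendsto_rectPartialSum_sub_mean hd hf (l := atTop ×ˢ 𝓟 K)
    (N := fun q : (Fin d → ℕ) × (Fin d → ℝ) => q.1) tendsto_fst (fun q => q.2)
    (fun q _ => f q.2) (B := S) (fun q _ => hS _) fun s ε hε => ?_
  · rw [Metric.tendstoUniformlyOn_iff]
    intro ε hε
    have h1 := (Metric.tendsto_nhds.1 key) ε hε
    rw [eventually_prod_principal_iff] at h1
    filter_upwards [h1] with N hN x hx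
    have h2 := hN x hx
    rw [dist_comm, dist_eq_norm]
    rw [dist_zero_right] at h2
    simpa using h2
  -- Continuity at the points of the compact `K` gives one `δ` for all of `K`, with the second point
  -- free to leave `K`.
  · have huc := hK.uniformContinuousAt_of_continuousAt f
      (fun a ha => hfU.continuousAt (hU.mem_nhds (hKU ha))) (Metric.dist_mem_uniformity hε)
    obtain ⟨δ, hδ, h⟩ := Metric.mem_uniformity_dist.1 huc
    refine ⟨δ, hδ, ?_⟩
    rw [eventually_prod_principal_iff]
    refine Eventually.of_forall fun N x hx t ht => ?_
    have h3 := dist_add_reflect_lt (x := x) s hδ ht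
    rw [dist_comm] at h3
    have h4 : dist (f x) (f (x + reflect s t)) < ε := h h3 hx
    rw [← dist_eq_norm, dist_comm]
    exact h4.le

end

end MultipleFourier

theorem mainTheorem5 (d : ℕ) (hd : 1 ≤ d) :
    MultipleFourier.IsClassOfConvergence d (MultipleFourier.modulusClass d) :=
  ⟨MultipleFourier.modulusClass_subset_L1 hd, fun _ hf =>
    ⟨fun _ _ hx => MultipleFourier.tendsto_rectPartialSum_of_isRegularPoint hd hf hx,
      fun _ _ hK _ hU hKU hfU =>
        MultipleFourier.tendstoUniformlyOn_rectPartialSum hd hf hK hU hKU hfU⟩⟩
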